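/- Let $n,m\ge 0$ and let $\mathbb G=F_n\times\mathbb Z^m$, where $F_n$ is the free group on $x_1,\dots,x_n$. Elements of $\mathbb G$ are written $u\,t^{a}$ with free part $u\in F_n$ and $a\in\mathbb Z^m$, and are given to algorithms as pairs (word in $x_1^{\pm1},\dots,x_n^{\pm1}$, integer vector); finitely generated subgroups are given by finite lists of generators. For a subgroup $\mathcal H\le\mathbb G$, $g\in\mathbb G$ and $k\ge1$: $g$ is a $k$-root of $\mathcal H$ if $g^k\in\mathcal H$, and $\sqrt[k]{\mathcal H}$ is the set of $k$-roots of $\mathcal H$ in $\mathbb G$; the order of $g$ in $\mathcal H$ is the least $j\ge1$ with $g^j\in\mathcal H$ (and $0$ if there is none), and $\mathcal O_k(\mathcal H)$ is the set of elements of $\mathbb G$ of order $k$ in $\mathcal H$. For $X\subseteq\mathbb G$ put $X^{\mathcal H}=\{h^{-1}xh : x\in X,\ h\in\mathcal H\}$. There are algorithms which, on input a finite list of generators of a subgroup $\mathcal H\le\mathbb G$ and an integer $k\ge1$, do the following. (1) Compute a finite set $S$ of $k$-roots $w\,t^{a_w}$ of $\mathcal H$, with pairwise distinct free parts $w$, and,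 for each of them, a finite set of generators of a subgroup $\mathcal H_w\le\mathbb G$, such that the cosets $\mathcal H_w\,w\,t^{a_w}$ are pairwise disjoint and $$\sqrt[k]{\mathcal H}=\Big(\bigsqcup_{w t^{a_w}\in S}\mathcal H_w\,w\,t^{a_w}\Big)^{\mathcal H}.$$ (2) Decide, for a further input $g\in\mathbb G$, whether $g\in\mathcal O_k(\mathcal H)$; decide whether $\mathcal O_k(\mathcal H)\ne\varnothing$; and compute a finite set $S'$ of elements of order $k$ in $\mathcal H$ and, for each $g\in S'$, a finite set of generators of a subgroup $\mathcal H'_g\le\mathbb G$, such that the cosets $\mathcal H'_g\,g$ are pairwise disjoint and $$\mathcal O_k(\mathcal H)=\Big(\bigsqcup_{g\in S'}\mathcal H'_g\,g\Big)^{\mathcal H}$$ (with $S'=\varnothing$ when $\mathcal O_k(\mathcal H)=\varnothing$). -/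

import Mathlib

namespace FreeTimesAbelian

section Relative

variable {G : Type*} [Group G]

/-- The set of `k`-roots of a subset `S` of a group. -/
def kRoots (k : ℕ) (S : Set G) : Set G := {g | g ^ k ∈ S}

/-- The relative order of `g` in `S`: the least `k ≥ 1` with `g ^ k ∈ S`, and `0` if there is
none (`sInf ∅ = 0` in `ℕ`). -/
noncomputable def relOrder (S : Set G) (g : G) : ℕ := sInf {k : ℕ | 1 ≤ k ∧ g ^ k ∈ S}

/-- The set of elements of the group having order `k` in `S`. -/
def ofOrder (k : ℕ) (S : Set G) : Set G := {g | relOrder S g = k}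

/-- `X ^ H`: the set of conjugates `h⁻¹ * x * h` with `x ∈ X` and `h ∈ H`. -/
def conjBy (X : Set G) (H : Subgroup G) : Set G := {y | ∃ h ∈ H, ∃ x ∈ X, y = h⁻¹ * x * h}

/-- The right coset `K g`. -/
def rightCoset (K : Subgroup G) (g : G) : Set G := {y | ∃ x ∈ K, y = x * g}

end Relative

/-- The group `F_n × ℤ^m`. -/
abbrev FTA (n m : ℕ) : Type := FreeGroup (Fin n) × Multiplicative (Fin m → ℤ)

/-- Codes for elements of `F_n × ℤ^m`: a (not necessarily reduced) word in the letters
`x₁^{±1}, …, x_n^{±1}` together with an integer vector. -/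
abbrev Code (n m : ℕ) : Type := List (Fin n × Bool) × (Fin m → ℤ)

/-- The element `u t^a` of `F_n × ℤ^m` given by a code. -/
def Code.elt {n m : ℕ} (x : Code n m) : FTA n m :=
  (FreeGroup.mk x.1, Multiplicative.ofAdd x.2)

/-- The subgroup of `F_n × ℤ^m` generated by a finite list of (coded) elements. -/
def subgroupOf {n m : ℕ} (L : List (Code n m)) : Subgroup (FTA n m) :=
  Subgroup.closure {g | ∃ x ∈ L, Code.elt x = g}

/-- Codes for cosets `K g` of finitely generated subgroups: a list of generators of `K`
and a representative `g`. -/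
abbrev CosetCode (n m : ℕ) : Type := List (Code n m) × Code n m

/-- The representative of a coded coset. -/
def CosetCode.rep {n m : ℕ} (c : CosetCode n m) : FTA n m := Code.elt c.2

/-- The coded coset, as a set. -/
def CosetCode.coset {n m : ℕ} (c : CosetCode n m) : Set (FTA n m) :=
  rightCoset (subgroupOf c.1) (CosetCode.rep c)

/-- `X = (⨆_{c ∈ D} coset c) ^ H`, the union over the list `D` being disjoint and all the
representatives of the cosets lying in `X`. -/
structure IsCosetDecomposition {n m : ℕ} (H : Subgroup (FTA n m)) (X : Set (FTA n m))
    (D : List (CosetCode n m)) : Prop where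
  rep_mem : ∀ c ∈ D, CosetCode.rep c ∈ X
  disjoint : D.Pairwise fun c c' => Disjoint (CosetCode.coset c) (CosetCode.coset c')
  eq : X = conjBy {g | ∃ c ∈ D, g ∈ CosetCode.coset c} H

end FreeTimesAbelian

/-!
Each of the data to be computed is characterized by recursively enumerable conditions, so that an
unbounded search finds it as soon as it is known to exist. Membership in a finitely generated
subgroup is clearly such a condition; so is non-membership, since a finite automaton whose
transitions permute the states and carry weights in `ℤ ^ m` certifies it.

If `g ^ k ∈ H`, then `g.1 ^ k` lies in the subgroup `P` of the `u` with `(u, k a) ∈ H` for some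
`a`, which is finitely generated. Writing `g.1` as `r c r⁻¹` with `c` cyclically reduced, and
tracing `r c ^ k r⁻¹` in the Schreier graph of `P`, one may replace `r` and `c` by words of bounded
length without changing the cosets `P g.1 ^ i`, `i ≤ k`, up to conjugation by `H`. This leaves
finitely many free parts, each to be taken up to left multiplication by the elements `x` that
preserve these cosets. For such `x`, all conjugates `g ^ i x g ^ (-i)`, `i < k`, lie in `H A`, where
`A` is the central factor. As commutators of elements of `H A` lie in `H`, the quotient `H A / H` is
abelian, and `(x g) ^ k g ^ (-k)` defines a homomorphism in `x` to it. The roots in a class hence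
form a coset of its kernel.

An element `x g` of this coset has order `k` unless `(x g) ^ j ∈ H` for some `0 < j < k`, which
requires `g ^ j ∈ H A`. For such `j`, the homomorphism belonging to the exponent `j` maps the kernel
to a group of exponent `k`, which is finite as the kernel is finitely generated. So whether `x g`
has order `k` depends only on the coset of `x` modulo a subgroup of finite index.
-/

attribute [fun_prop] Primrec REPred

attribute [fun_prop] Primrec.id Primrec.const Primrec.comp Primrec.pair Primrec.fst Primrec.snd
  Primrec.succ Primrec.encode Primrec.not Primrec.list_reverse Primrec.list_length

namespace FreeTimesAbelian

section RecursivelyEnumerable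

variable {α β γ : Type*} [Primcodable α] [Primcodable β] [Primcodable γ]

theorem rePred_iff_exists_primrecRel {p : α → Prop} :
    REPred p ↔ ∃ q : α → ℕ → Prop, PrimrecRel q ∧ ∀ a, p a ↔ ∃ n, q a n := by
  classical
  constructor
  · intro hp
    obtain ⟨c, hc⟩ := Nat.Partrec.Code.exists_code.1 hp
    refine ⟨fun a n => (c.evaln n (Encodable.encode a)).isSome = true, ?_, fun a => ?_⟩
    · exact Primrec.eq.comp (Primrec.option_isSome.comp (Nat.Partrec.Code.primrec_evaln.comp
        (g := fun x : α × ℕ => ((x.2, c), Encodable.encode x.1)) (by fun_prop)))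
        (Primrec.const true)
    · have hdom : p a ↔ (c.eval (Encodable.encode a)).Dom := by simp [hc, Part.assert]
      rw [hdom, Part.dom_iff_mem]
      simp only [Nat.Partrec.Code.evaln_complete, Option.isSome_iff_exists, Option.mem_def]
      exact exists_comm
  · rintro ⟨q, hq, hpq⟩
    have hfind : Partrec fun a => Nat.rfindOpt fun n => if q a n then some () else none :=
      Partrec.rfindOpt (Primrec.ite hq (Primrec.const _) (Primrec.const _)).to_comp
    refine hfind.dom_re.of_eq fun a => ?_
    simp [Nat.rfindOpt_dom, hpq]

@[fun_prop]
theorem rePred_comp {p : β → Prop} (hp : REPred p) {f : α → β} (hf : Primrec f) :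
    REPred fun a => p (f a) := by
  obtain ⟨q, hq, hpq⟩ := rePred_iff_exists_primrecRel.1 hp
  exact rePred_iff_exists_primrecRel.2 ⟨fun a n => q (f a) n,
    PrimrecRel.comp (R := q) hq (hf.comp Primrec.fst) Primrec.snd, fun a => hpq (f a)⟩

theorem rePred_of_primrecPred {p : α → Prop} (hp : PrimrecPred p) : REPred p :=
  rePred_iff_exists_primrecRel.2
    ⟨fun a _ => p a, hp.comp (f := fun x : α × ℕ => x.1) Primrec.fst, fun a => by simp⟩

@[fun_prop]
theorem rePred_eq {f g : α → β} (hf : Primrec f) (hg : Primrec g) : REPred fun a => f a = g a :=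
  rePred_of_primrecPred (Primrec.eq.comp hf hg)

@[fun_prop]
theorem rePred_ne {f g : α → β} (hf : Primrec f) (hg : Primrec g) : REPred fun a => f a ≠ g a :=
  rePred_of_primrecPred (Primrec.eq.comp hf hg).not

@[fun_prop]
theorem rePred_exists {p : α → β → Prop} (hp : REPred fun x : α × β => p x.1 x.2) :
    REPred fun a => ∃ b, p a b := by
  classical
  obtain ⟨q, hq, hpq⟩ := rePred_iff_exists_primrecRel.1 hp
  refine rePred_iff_exists_primrecRel.2
    ⟨fun a n => ∃ b ∈ (Encodable.decode (α := β) n.unpair.1).toList, q (a, b) n.unpair.2, ?_,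
      fun a => ⟨?_, ?_⟩⟩
  · have hrel : PrimrecRel fun (b : β) (y : α × ℕ) => q (y.1, b) y.2.unpair.2 :=
      PrimrecRel.comp (R := q) hq (f := fun z : β × α × ℕ => (z.2.1, z.1)) (by fun_prop)
        (Primrec.snd.comp (Primrec.unpair.comp (by fun_prop)))
    exact PrimrecRel.comp hrel.exists_mem_list
      (Primrec.optionToList.comp (Primrec.decode.comp
        (Primrec.fst.comp (Primrec.unpair.comp Primrec.snd)))) Primrec.id
  · rintro ⟨b, hb⟩
    obtain ⟨j, hj⟩ := (hpq (a, b)).1 hb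
    exact ⟨Nat.pair (Encodable.encode b) j, b, by simp, by simpa using hj⟩
  · rintro ⟨n, b, -, hb⟩
    exact ⟨b, (hpq (a, b)).2 ⟨_, hb⟩⟩

@[fun_prop]
theorem rePred_and {p q : α → Prop} (hp : REPred p) (hq : REPred q) :
    REPred fun a => p a ∧ q a := by
  obtain ⟨r, hr, hpr⟩ := rePred_iff_exists_primrecRel.1 hp
  obtain ⟨s, hs, hqs⟩ := rePred_iff_exists_primrecRel.1 hq
  have hrs : REPred fun a => ∃ i j, r a i ∧ s a j := by
    refine rePred_exists (rePred_exists (rePred_of_primrecPred ?_))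
    exact (PrimrecRel.comp (R := r) hr (f := fun x : (α × ℕ) × ℕ => x.1.1) (g := fun x => x.1.2)
      (by fun_prop) (by fun_prop)).and (PrimrecRel.comp (R := s) hs (by fun_prop) (by fun_prop))
  exact hrs.of_eq fun a => by rw [hpr, hqs, exists_and_exists_comm]

@[fun_prop]
theorem rePred_or {p q : α → Prop} (hp : REPred p) (hq : REPred q) :
    REPred fun a => p a ∨ q a := by
  obtain ⟨r, hr, hpr⟩ := rePred_iff_exists_primrecRel.1 hp
  obtain ⟨s, hs, hqs⟩ := rePred_iff_exists_primrecRel.1 hq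
  refine rePred_iff_exists_primrecRel.2
    ⟨fun a n => r a n ∨ s a n, PrimrecPred.or hr hs, fun a => ?_⟩
  simp only [hpr, hqs, exists_or]

@[fun_prop]
theorem rePred_bex {p : α → β → Prop} (hp : REPred fun x : α × β => p x.1 x.2) {l : α → List β}
    (hl : Primrec l) : REPred fun a => ∃ b ∈ l a, p a b := by
  classical
  have heq : PrimrecRel fun b c : β => b = c := Primrec.eq
  have hmem : PrimrecPred fun x : α × β => x.2 ∈ l x.1 :=
    (heq.exists_mem_list.comp (hl.comp Primrec.fst) Primrec.snd).of_eq fun x => by simp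
  exact rePred_exists (rePred_and (rePred_of_primrecPred hmem) hp)

@[fun_prop]
theorem rePred_ball {p : α → β → Prop} (hp : REPred fun x : α × β => p x.1 x.2) {l : α → List β}
    (hl : Primrec l) : REPred fun a => ∀ b ∈ l a, p a b := by
  classical
  obtain ⟨q, hq, hpq⟩ := rePred_iff_exists_primrecRel.1 hp
  refine rePred_iff_exists_primrecRel.2
    ⟨fun a N => ∀ b ∈ l a, ∃ i ∈ List.range N, q (a, b) i, ?_, fun a => ⟨fun h => ?_, ?_⟩⟩
  · have hrel : PrimrecRel fun (i : ℕ) (y : β × α × ℕ) => q (y.2.1, y.1) i :=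
      PrimrecRel.comp (R := q) hq (f := fun z : ℕ × β × α × ℕ => (z.2.2.1, z.2.1))
        (by fun_prop) Primrec.fst
    have hbdd : PrimrecRel fun (b : β) (y : α × ℕ) => ∃ i ∈ List.range y.2, q (y.1, b) i :=
      PrimrecRel.comp hrel.exists_mem_list (f := fun y : β × α × ℕ => List.range y.2.2) (g := id)
        (Primrec.list_range.comp (by fun_prop)) Primrec.id
    exact PrimrecRel.comp hbdd.forall_mem_list (hl.comp Primrec.fst) Primrec.id
  · have hev : ∀ b ∈ (l a).toFinset, ∀ᶠ N in Filter.atTop, ∃ i ∈ List.range N, q (a, b) i := by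
      intro b hb
      obtain ⟨i, hi⟩ := (hpq (a, b)).1 (h b (List.mem_toFinset.1 hb))
      filter_upwards [Filter.eventually_gt_atTop i] with N hN
      exact ⟨i, List.mem_range.2 hN, hi⟩
    obtain ⟨N, hN⟩ := ((Filter.eventually_all_finset _).2 hev).exists
    exact ⟨N, fun b hb => hN b (List.mem_toFinset.2 hb)⟩
  · rintro ⟨N, hN⟩ b hb
    obtain ⟨i, -, hi⟩ := hN b hb
    exact (hpq (a, b)).2 ⟨i, hi⟩

@[fun_prop]
theorem rePred_list_mem {f : α → β} {l : α → List β} (hf : Primrec f) (hl : Primrec l) :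
    REPred fun a => f a ∈ l a :=
  REPred.of_eq (p := fun a => ∃ b ∈ l a, b = f a) (by fun_prop) fun a => by simp

@[fun_prop]
theorem rePred_forall_lt {p : α → ℕ → Prop} (hp : REPred fun x : α × ℕ => p x.1 x.2) {f : α → ℕ}
    (hf : Primrec f) : REPred fun a => ∀ i < f a, p a i :=
  (rePred_ball hp (Primrec.list_range.comp hf)).of_eq fun a => by simp

@[fun_prop]
theorem rePred_exists_lt {p : α → ℕ → Prop} (hp : REPred fun x : α × ℕ => p x.1 x.2) {f : α → ℕ}
    (hf : Primrec f) : REPred fun a => ∃ i < f a, p a i :=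
  (rePred_bex hp (Primrec.list_range.comp hf)).of_eq fun a => by simp

@[fun_prop]
theorem rePred_pairwise {p : α → β → β → Prop} (hp : REPred fun x : α × β × β => p x.1 x.2.1 x.2.2)
    {l : α → List β} (hl : Primrec l) : REPred fun a => (l a).Pairwise (p a) := by
  have hentry : REPred fun x : ((α × ℕ) × ℕ) × β × β =>
      (l x.1.1.1)[x.1.2]? = some x.2.1 ∧ (l x.1.1.1)[x.1.1.2]? = some x.2.2 ∧
        p x.1.1.1 x.2.1 x.2.2 :=
    rePred_and (rePred_eq (Primrec.list_getElem?.comp (by fun_prop) (by fun_prop))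
        (Primrec.option_some.comp (by fun_prop)))
      (rePred_and (rePred_eq (Primrec.list_getElem?.comp (by fun_prop) (by fun_prop))
        (Primrec.option_some.comp (by fun_prop)))
        (rePred_comp hp (f := fun x : ((α × ℕ) × ℕ) × β × β => (x.1.1.1, x.2)) (by fun_prop)))
  have hindex : REPred fun a => ∀ i < (l a).length, ∀ j < i, ∃ y : β × β,
      (l a)[j]? = some y.1 ∧ (l a)[i]? = some y.2 ∧ p a y.1 y.2 :=
    rePred_forall_lt (rePred_forall_lt (rePred_exists hentry) (by fun_prop)) (by fun_prop)
  refine hindex.of_eq fun a => ?_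
  rw [List.pairwise_iff_getElem]
  constructor
  · intro h i j hi hj hij
    obtain ⟨⟨b, c⟩, hb, hc, hbc⟩ := h j hj i hij
    simp only [List.getElem?_eq_getElem, hi, hj, Option.some.injEq] at hb hc
    rwa [hb, hc]
  · intro h i hi j hj
    exact ⟨((l a)[j], (l a)[i]), by simp [hj.trans hi], by simp [hi], h j i (hj.trans hi) hi hj⟩

theorem exists_computable_of_rePred {p : α → β → Prop} (hp : REPred fun x : α × β => p x.1 x.2)
    (h : ∀ a, ∃ b, p a b) : ∃ f : α → β, Computable f ∧ ∀ a, p a (f a) := by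
  classical
  obtain ⟨q, hq, hpq⟩ := rePred_iff_exists_primrecRel.1 hp
  let search : α → ℕ → Option β := fun a n =>
    (Encodable.decode n.unpair.1).bind fun b => if q (a, b) n.unpair.2 then some b else none
  have hsearch : Primrec₂ search := by
    refine Primrec.option_bind (Primrec.decode.comp (Primrec.fst.comp
      (Primrec.unpair.comp Primrec.snd))) ?_
    refine Primrec.ite ?_ (Primrec.option_some.comp Primrec.snd) (Primrec.const none)
    exact PrimrecRel.comp (R := q) hq
      (Primrec.pair (Primrec.fst.comp Primrec.fst) Primrec.snd)
      (Primrec.snd.comp (Primrec.unpair.comp (Primrec.snd.comp Primrec.fst)))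
  have hdom : ∀ a, (Nat.rfindOpt (search a)).Dom := fun a => by
    obtain ⟨b, hb⟩ := h a
    obtain ⟨i, hi⟩ := (hpq (a, b)).1 hb
    exact Nat.rfindOpt_dom.2 ⟨Nat.pair (Encodable.encode b) i, b, by simp [search, hi]⟩
  refine ⟨fun a => (Nat.rfindOpt (search a)).get (hdom a), ?_, fun a => ?_⟩
  · exact (Partrec.rfindOpt hsearch.to_comp).of_eq fun a => (Part.some_get (hdom a)).symm
  · obtain ⟨n, hn⟩ := Nat.rfindOpt_spec (Part.get_mem (hdom a))
    obtain ⟨b, -, hb⟩ := Option.bind_eq_some_iff.1 hn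
    split_ifs at hb with hqb
    have hpb : p a b := (hpq (a, b)).2 ⟨_, hqb⟩
    rwa [Option.some.inj hb] at hpb

theorem exists_computable_decide {p : α → Prop} (hp : REPred p) (hn : REPred fun a => ¬ p a) :
    ∃ f : α → Bool, Computable f ∧ ∀ a, f a = true ↔ p a := by
  obtain ⟨f, hf, rfl⟩ :=
    ComputablePred.computable_iff.1 (ComputablePred.computable_iff_re_compl_re'.2 ⟨hp, hn⟩)
  exact ⟨f, hf, fun a => Iff.rfl⟩

end RecursivelyEnumerable

section PrimitiveRecursive

variable {α β γ σ : Type*} [Primcodable α] [Primcodable β] [Primcodable γ] [Primcodable σ]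

@[fun_prop]
theorem primrec_append {f g : α → List β} (hf : Primrec f) (hg : Primrec g) :
    Primrec fun a => f a ++ g a := Primrec.list_append.comp hf hg

@[fun_prop]
theorem primrec_cons {f : α → β} {g : α → List β} (hf : Primrec f) (hg : Primrec g) :
    Primrec fun a => f a :: g a := Primrec.list_cons.comp hf hg

@[fun_prop]
theorem primrec_map {f : α → List β} {g : α → β → γ} (hf : Primrec f)
    (hg : Primrec fun x : α × β => g x.1 x.2) : Primrec fun a => (f a).map (g a) :=
  Primrec.list_map hf hg

@[fun_prop]
theorem primrec_flatMap {f : α → List β} {g : α → β → List γ} (hf : Primrec f)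
    (hg : Primrec fun x : α × β => g x.1 x.2) : Primrec fun a => (f a).flatMap (g a) :=
  Primrec.list_flatMap hf hg

theorem primrec_foldr {f : α → List β} {g : α → σ} {h : α → β → σ → σ} (hf : Primrec f)
    (hg : Primrec g) (hh : Primrec fun x : α × β × σ => h x.1 x.2.1 x.2.2) :
    Primrec fun a => (f a).foldr (h a) (g a) :=
  Primrec.list_foldr (h := fun a x => h a x.1 x.2) hf hg hh

@[fun_prop]
theorem primrec_nat_add {f g : α → ℕ} (hf : Primrec f) (hg : Primrec g) :
    Primrec fun a => f a + g a := Primrec.nat_add.comp hf hg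

@[fun_prop]
theorem primrec_nat_sub {f g : α → ℕ} (hf : Primrec f) (hg : Primrec g) :
    Primrec fun a => f a - g a := Primrec.nat_sub.comp hf hg

@[fun_prop]
theorem primrec_nat_mul {f g : α → ℕ} (hf : Primrec f) (hg : Primrec g) :
    Primrec fun a => f a * g a := Primrec.nat_mul.comp hf hg

@[fun_prop]
theorem primrec_nat_pow {f g : α → ℕ} (hf : Primrec f) (hg : Primrec g) :
    Primrec fun a => f a ^ g a :=
  (Primrec₂.unpaired'.1 Nat.Primrec.pow).comp hf hg

end PrimitiveRecursive

section Integers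

theorem encode_int_natCast (k : ℕ) : Encodable.encode (k : ℤ) = 2 * k := rfl

theorem encode_int_negSucc (k : ℕ) : Encodable.encode (Int.negSucc k) = 2 * k + 1 := rfl

theorem primrec_int_subNat : Primrec fun x : ℕ × ℕ => (x.1 : ℤ) - x.2 := by
  have h : Primrec fun x : ℕ × ℕ =>
      if x.2 ≤ x.1 then 2 * (x.1 - x.2) else 2 * (x.2 - x.1 - 1) + 1 :=
    Primrec.ite (Primrec.nat_le.comp Primrec.snd Primrec.fst) (by fun_prop) (by fun_prop)
  refine Primrec.encode_iff.1 (h.of_eq fun x => ?_)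
  split_ifs with hx
  · rw [← Int.ofNat_sub hx, encode_int_natCast]
  · rw [show (x.1 : ℤ) - x.2 = Int.negSucc (x.2 - x.1 - 1) by rw [Int.negSucc_eq]; omega,
      encode_int_negSucc]

variable {α : Type*} [Primcodable α]

theorem primrec_int_toNat : Primrec Int.toNat := by
  have h : Primrec fun z : ℤ =>
      bif (Encodable.encode z).bodd then 0 else (Encodable.encode z).div2 :=
    Primrec.cond (Primrec.nat_bodd.comp Primrec.encode) (Primrec.const 0)
      (Primrec.nat_div2.comp Primrec.encode)
  refine h.of_eq fun z => ?_
  cases z with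
  | ofNat k =>
    rw [Int.ofNat_eq_natCast, encode_int_natCast]
    simp [Nat.div2_val]
  | negSucc k =>
    rw [encode_int_negSucc]
    simp

theorem primrec_int_neg_toNat : Primrec fun z : ℤ => (-z).toNat := by
  have h : Primrec fun z : ℤ =>
      bif (Encodable.encode z).bodd then (Encodable.encode z).div2 + 1 else 0 :=
    Primrec.cond (Primrec.nat_bodd.comp Primrec.encode)
      (Primrec.succ.comp (Primrec.nat_div2.comp Primrec.encode)) (Primrec.const 0)
  refine h.of_eq fun z => ?_
  cases z with
  | ofNat k =>
    rw [Int.ofNat_eq_natCast, encode_int_natCast]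
    simp
  | negSucc k =>
    rw [encode_int_negSucc]
    simp [Nat.div2_val, Int.neg_negSucc]

@[fun_prop]
theorem primrec_int_add {f g : α → ℤ} (hf : Primrec f) (hg : Primrec g) :
    Primrec fun a => f a + g a := by
  have h : Primrec fun a => (((f a).toNat + (g a).toNat : ℕ) : ℤ) -
      ((-f a).toNat + (-g a).toNat : ℕ) :=
    primrec_int_subNat.comp (g := fun a => (_, _)) (by
      have hf₁ := primrec_int_toNat.comp hf
      have hg₁ := primrec_int_toNat.comp hg
      have hf₂ := primrec_int_neg_toNat.comp hf
      have hg₂ := primrec_int_neg_toNat.comp hg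
      fun_prop)
  refine h.of_eq fun a => ?_
  omega

@[fun_prop]
theorem primrec_int_mul {f g : α → ℤ} (hf : Primrec f) (hg : Primrec g) :
    Primrec fun a => f a * g a := by
  have h : Primrec fun a =>
      (((f a).toNat * (g a).toNat + (-f a).toNat * (-g a).toNat : ℕ) : ℤ) -
        ((f a).toNat * (-g a).toNat + (-f a).toNat * (g a).toNat : ℕ) :=
    primrec_int_subNat.comp (g := fun a => (_, _)) (by
      have hf₁ := primrec_int_toNat.comp hf
      have hg₁ := primrec_int_toNat.comp hg
      have hf₂ := primrec_int_neg_toNat.comp hf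
      have hg₂ := primrec_int_neg_toNat.comp hg
      fun_prop)
  refine h.of_eq fun a => ?_
  conv_rhs => rw [← Int.toNat_sub_toNat_neg (f a), ← Int.toNat_sub_toNat_neg (g a)]
  push_cast
  ring

@[fun_prop]
theorem primrec_int_neg {f : α → ℤ} (hf : Primrec f) : Primrec fun a => -f a :=
  (primrec_int_mul (Primrec.const (-1)) hf).of_eq fun a => by ring

theorem primrecPred_natCast_dvd_int {f : α → ℕ} {g : α → ℤ} (hf : Primrec f) (hg : Primrec g) :
    PrimrecPred fun a => (f a : ℤ) ∣ g a := by
  have h : PrimrecPred fun a => ((g a).toNat + (-g a).toNat) % f a = 0 :=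
    Primrec.eq.comp (Primrec.nat_mod.comp (primrec_nat_add (primrec_int_toNat.comp hg)
      (primrec_int_neg_toNat.comp hg)) hf) (Primrec.const 0)
  refine h.of_eq fun a => ?_
  rw [← Nat.dvd_iff_mod_eq_zero, Int.natCast_dvd]
  congr! 1
  omega

end Integers

section Groups

/-- Groups whose elements are coded in such a way that multiplication and inversion are primitive
recursive. -/
class PrimrecGroup (G : Type*) [Group G] [Primcodable G] : Prop where
  primrec_mul : Primrec₂ fun g h : G => g * h
  primrec_inv : Primrec fun g : G => g⁻¹

variable {α G H : Type*} [Primcodable α] [Group G] [Primcodable G] [PrimrecGroup G]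
  [Group H] [Primcodable H] [PrimrecGroup H]

@[fun_prop]
theorem primrec_mul {f g : α → G} (hf : Primrec f) (hg : Primrec g) :
    Primrec fun a => f a * g a :=
  PrimrecGroup.primrec_mul.comp hf hg

@[fun_prop]
theorem primrec_inv {f : α → G} (hf : Primrec f) : Primrec fun a => (f a)⁻¹ :=
  PrimrecGroup.primrec_inv.comp hf

@[fun_prop]
theorem primrec_pow {f : α → G} {k : α → ℕ} (hf : Primrec f) (hk : Primrec k) :
    Primrec fun a => f a ^ k a := by
  have h : Primrec fun a => (Nat.rec 1 (fun _ x => x * f a) (k a) : G) :=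
    Primrec.nat_rec' (h := fun a y => y.2 * f a) hk (Primrec.const 1)
      (primrec_mul (by fun_prop) (by fun_prop))
  refine h.of_eq fun a => ?_
  induction k a with
  | zero => simp
  | succ k ih => rw [pow_succ, ← ih]

@[fun_prop]
theorem primrec_list_prod {f : α → List G} (hf : Primrec f) : Primrec fun a => (f a).prod :=
  (primrec_foldr (h := fun _ x y => x * y) hf (Primrec.const 1) (by fun_prop)).of_eq fun _ =>
    List.prod_eq_foldr.symm

instance : PrimrecGroup (G × H) where
  primrec_mul := show Primrec fun x : (G × H) × (G × H) => (x.1.1 * x.2.1, x.1.2 * x.2.2) by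
    fun_prop
  primrec_inv := show Primrec fun x : G × H => (x.1⁻¹, x.2⁻¹) by fun_prop

end Groups

section FreeGroups

variable {X α : Type*} [Primcodable X] [Primcodable α]

@[fun_prop]
theorem primrec_invRev {f : α → List (X × Bool)} (hf : Primrec f) :
    Primrec fun a => FreeGroup.invRev (f a) := by
  unfold FreeGroup.invRev
  have : Primrec not := Primrec.not
  fun_prop

variable [DecidableEq X]

@[fun_prop]
theorem primrec_reduce {f : α → List (X × Bool)} (hf : Primrec f) :
    Primrec fun a => FreeGroup.reduce (f a) := by
  have h : Primrec fun a => (f a).foldr (fun x l => (List.casesOn l [x] fun hd tl =>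
      if x.1 = hd.1 ∧ x.2 = not hd.2 then tl else x :: hd :: tl : List (X × Bool))) [] := by
    refine primrec_foldr (h := fun _ x l => (List.casesOn l [x] fun hd tl =>
      if x.1 = hd.1 ∧ x.2 = not hd.2 then tl else x :: hd :: tl)) hf (Primrec.const []) ?_
    refine Primrec.list_casesOn (h := fun (z : α × (X × Bool) × List (X × Bool))
        (w : (X × Bool) × List (X × Bool)) =>
      if z.2.1.1 = w.1.1 ∧ z.2.1.2 = not w.1.2 then w.2 else z.2.1 :: w.1 :: w.2) (by fun_prop)
      (by fun_prop) ?_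
    exact Primrec.ite (PrimrecPred.and (Primrec.eq.comp (by fun_prop) (by fun_prop))
      (Primrec.eq.comp (by fun_prop) (Primrec.not.comp (by fun_prop)))) (by fun_prop) (by fun_prop)
  refine h.of_eq fun a => ?_
  induction f a with
  | nil => rfl
  | cons x l ih => rw [List.foldr_cons, ih, FreeGroup.reduce.cons]

/-- The bijection between a free group and the reduced words by which the elements of the free
group are coded. -/
def freeGroupEquivReduced : FreeGroup X ≃ {w : List (X × Bool) // FreeGroup.reduce w = w} where
  toFun u := ⟨u.toWord, u.reduce_toWord⟩
  invFun w := FreeGroup.mk w.1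
  left_inv _ := FreeGroup.mk_toWord
  right_inv w := Subtype.ext (FreeGroup.toWord_mk.trans w.2)

theorem primrecPred_reduce_eq : PrimrecPred fun w : List (X × Bool) => FreeGroup.reduce w = w :=
  Primrec.eq.comp (by fun_prop) (by fun_prop)

instance : Primcodable {w : List (X × Bool) // FreeGroup.reduce w = w} :=
  Primcodable.subtype primrecPred_reduce_eq

instance : Primcodable (FreeGroup X) := Primcodable.ofEquiv _ freeGroupEquivReduced

@[fun_prop]
theorem primrec_toWord {f : α → FreeGroup X} (hf : Primrec f) : Primrec fun a => (f a).toWord :=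
  (Primrec.subtype_val (hp := primrecPred_reduce_eq)).comp
    ((Primrec.of_equiv (e := freeGroupEquivReduced)).comp hf)

@[fun_prop]
theorem primrec_freeGroup_mk {f : α → List (X × Bool)} (hf : Primrec f) :
    Primrec fun a => FreeGroup.mk (f a) := by
  have h : Primrec fun a => freeGroupEquivReduced.symm
      ⟨FreeGroup.reduce (f a), FreeGroup.reduce.idem⟩ :=
    (Primrec.of_equiv_symm (e := freeGroupEquivReduced)).comp
      (Primrec.subtype_mk (hp := primrecPred_reduce_eq) (by fun_prop))
  exact h.of_eq fun a => FreeGroup.reduce.self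

instance : PrimrecGroup (FreeGroup X) where
  primrec_mul := Primrec.of_eq
    (f := fun x : FreeGroup X × FreeGroup X => FreeGroup.mk (x.1.toWord ++ x.2.toWord))
    (by fun_prop) fun x => by rw [← FreeGroup.mul_mk, FreeGroup.mk_toWord, FreeGroup.mk_toWord]
  primrec_inv := Primrec.of_eq
    (f := fun x : FreeGroup X => FreeGroup.mk (FreeGroup.invRev x.toWord))
    (by fun_prop) fun x => by rw [← FreeGroup.inv_mk, FreeGroup.mk_toWord]

end FreeGroups

section Vectors

variable {m : ℕ} {α : Type*} [Primcodable α]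

theorem primrec_vec_apply {f : α → Fin m → ℤ} {i : α → Fin m} (hf : Primrec f) (hi : Primrec i) :
    Primrec fun a => f a (i a) :=
  Primrec.fin_app.comp hf hi

theorem primrec_vec {f : α → Fin m → ℤ} (hf : Primrec fun x : α × Fin m => f x.1 x.2) :
    Primrec f :=
  Primrec.fin_curry.2 hf

instance : Primcodable (Multiplicative (Fin m → ℤ)) := inferInstanceAs (Primcodable (Fin m → ℤ))

@[fun_prop]
theorem primrec_toAdd {f : α → Multiplicative (Fin m → ℤ)} (hf : Primrec f) :
    Primrec fun a => (f a).toAdd := hf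

@[fun_prop]
theorem primrec_ofAdd {f : α → Fin m → ℤ} (hf : Primrec f) :
    Primrec fun a => Multiplicative.ofAdd (f a) := hf

instance : PrimrecGroup (Multiplicative (Fin m → ℤ)) where
  primrec_mul := primrec_vec (f := fun x : (Fin m → ℤ) × (Fin m → ℤ) => x.1 + x.2)
    (primrec_int_add (primrec_vec_apply (by fun_prop) (by fun_prop))
      (primrec_vec_apply (by fun_prop) (by fun_prop)))
  primrec_inv := primrec_vec (f := fun x : Fin m → ℤ => -x)
    (primrec_int_neg (primrec_vec_apply (by fun_prop) (by fun_prop)))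

@[fun_prop]
theorem primrec_dotProduct {f g : α → Fin m → ℤ} (hf : Primrec f) (hg : Primrec g) :
    Primrec fun a => f a ⬝ᵥ g a := by
  have h : Primrec fun a => (List.finRange m).foldr (fun i s => f a i * g a i + s) 0 :=
    primrec_foldr (h := fun a i s => f a i * g a i + s) (Primrec.const _) (Primrec.const 0)
      (primrec_int_add (primrec_int_mul (primrec_vec_apply (by fun_prop) (by fun_prop))
        (primrec_vec_apply (by fun_prop) (by fun_prop))) (by fun_prop))
  refine h.of_eq fun a => ?_
  rw [dotProduct, Fin.sum_univ_def, List.sum_eq_foldr, List.foldr_map]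

end Vectors

section GeneratedSubgroups

variable {G H : Type*} [Group G] [Group H]

/-- The subgroup generated by a finite list of elements. -/
def gen (L : List G) : Subgroup G := Subgroup.closure {g | g ∈ L}

theorem mem_gen_of_mem {L : List G} {g : G} (hg : g ∈ L) : g ∈ gen L :=
  Subgroup.subset_closure hg

theorem gen_le_iff {L : List G} {K : Subgroup G} : gen L ≤ K ↔ ∀ g ∈ L, g ∈ K :=
  Subgroup.closure_le K

theorem gen_map (f : G →* H) (L : List G) : gen (L.map f) = (gen L).map f := by
  rw [gen, gen, MonoidHom.map_closure]
  congr 1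
  ext h
  simp

theorem fg_gen (L : List G) : (gen L).FG := by
  classical
  exact ⟨L.toFinset, by simp [gen]⟩

theorem exists_gen_eq {K : Subgroup G} (hK : K.FG) : ∃ L, gen L = K := by
  obtain ⟨S, rfl⟩ := hK
  exact ⟨S.toList, by simp [gen]⟩

theorem mem_gen_iff_exists_list {L : List G} {x : G} :
    x ∈ gen L ↔ ∃ c : List G, (∀ z ∈ c, z ∈ L ∨ z⁻¹ ∈ L) ∧ c.prod = x := by
  constructor
  · intro hx
    rw [gen, ← Subgroup.mem_toSubmonoid, Subgroup.closure_toSubmonoid] at hx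
    exact Submonoid.exists_list_of_mem_closure hx
  · rintro ⟨c, hc, rfl⟩
    refine Subgroup.list_prod_mem _ fun z hz => ?_
    rcases hc z hz with h | h
    · exact mem_gen_of_mem h
    · exact inv_mem_iff.1 (mem_gen_of_mem h)

end GeneratedSubgroups

section MembershipProblem

variable {α G H : Type*} [Primcodable α] [Group G] [Primcodable G] [Group H] [Primcodable H]

@[fun_prop]
theorem rePred_mem_gen [PrimrecGroup G] {x : α → G} {L : α → List G} (hx : Primrec x)
    (hL : Primrec L) : REPred fun a => x a ∈ gen (L a) :=
  REPred.of_eq (p := fun a => ∃ c : List G, (∀ z ∈ c, z ∈ L a ∨ z⁻¹ ∈ L a) ∧ c.prod = x a)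
    (by fun_prop) fun _ => mem_gen_iff_exists_list.symm

@[fun_prop]
theorem rePred_gen_le_gen [PrimrecGroup G] {L M : α → List G} (hL : Primrec L) (hM : Primrec M) :
    REPred fun a => gen (L a) ≤ gen (M a) :=
  REPred.of_eq (p := fun a => ∀ g ∈ L a, g ∈ gen (M a)) (by fun_prop) fun _ => gen_le_iff.symm

/-- Groups in which membership in finitely generated subgroups is decidable, uniformly in the
generators. As membership is always recursively enumerable, only non-membership is mentioned. -/
class SolvableMembership (G : Type*) [Group G] [Primcodable G] : Prop where
  rePred_notMem : REPred fun x : List G × G => x.2 ∉ gen x.1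

@[fun_prop]
theorem rePred_notMem_gen [SolvableMembership G] {x : α → G} {L : α → List G} (hx : Primrec x)
    (hL : Primrec L) : REPred fun a => x a ∉ gen (L a) :=
  rePred_comp (p := fun x : List G × G => x.2 ∉ gen x.1) (f := fun a => (L a, x a))
    SolvableMembership.rePred_notMem (hL.pair hx)

theorem SolvableMembership.of_injective [SolvableMembership H] {f : G →* H}
    (hf : Function.Injective f) (hf' : Primrec f) : SolvableMembership G where
  rePred_notMem := REPred.of_eq (p := fun x : List G × G => f x.2 ∉ gen (x.1.map f))
    (rePred_notMem_gen (by fun_prop) (by fun_prop)) fun x => by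
      rw [gen_map, Subgroup.mem_map_iff_mem hf]

end MembershipProblem

section AbelianMembership

variable {m : ℕ}

theorem exists_dotProduct_of_addMonoidHom {q : ℕ} (ψ : (Fin m → ℤ) →+ ZMod q) :
    ∃ χ : Fin m → ℤ, ∀ v, ψ v = (χ ⬝ᵥ v : ℤ) := by
  choose χ hχ using fun i => ZMod.intCast_surjective (ψ (Pi.single i 1))
  refine ⟨χ, fun v => ?_⟩
  have hv : v = ∑ i, v i • (Pi.single i 1 : Fin m → ℤ) := by
    ext j
    simp [Finset.sum_apply, Pi.single_apply]
  conv_lhs => rw [hv]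
  rw [map_sum, dotProduct, Int.cast_sum]
  refine Finset.sum_congr rfl fun i _ => ?_
  rw [map_zsmul, Int.cast_mul, hχ, zsmul_eq_mul, mul_comm]

theorem exists_addMonoidHom_zmod_ne_zero {A : Type*} [AddCommGroup A] [AddGroup.FG A] {a : A}
    (ha : a ≠ 0) : ∃ (q : ℕ) (ψ : A →+ ZMod q), ψ a ≠ 0 := by
  classical
  obtain ⟨r, ι, _, p, _, e, ⟨E⟩⟩ := AddCommGroup.equiv_free_prod_directSum_zmod A
  have hE : E a ≠ 0 := by simpa using ha
  by_cases hfree : (E a).1 = 0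
  · obtain ⟨i, hi⟩ : ∃ i, (E a).2 i ≠ 0 := by
      by_contra! h
      exact hE (Prod.ext hfree (DFinsupp.ext h))
    exact ⟨_, ((DFinsupp.evalAddMonoidHom i).comp (AddMonoidHom.snd _ _)).comp E.toAddMonoidHom,
      hi⟩
  · obtain ⟨i, hi⟩ : ∃ i, (E a).1 i ≠ 0 := by
      by_contra! h
      exact hfree (Finsupp.ext h)
    exact ⟨0, ((Finsupp.applyAddHom i).comp (AddMonoidHom.fst _ _)).comp E.toAddMonoidHom, hi⟩

theorem notMem_addSubgroup_iff_exists_dvd {S : AddSubgroup (Fin m → ℤ)} {b : Fin m → ℤ} :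
    b ∉ S ↔ ∃ (χ : Fin m → ℤ) (q : ℕ), (∀ s ∈ S, (q : ℤ) ∣ χ ⬝ᵥ s) ∧ ¬ (q : ℤ) ∣ χ ⬝ᵥ b := by
  constructor
  · intro hb
    have : AddGroup.FG ((Fin m → ℤ) ⧸ S) :=
      AddGroup.fg_of_surjective (f := QuotientAddGroup.mk' S) (QuotientAddGroup.mk'_surjective S)
    obtain ⟨q, ψ, hψ⟩ := exists_addMonoidHom_zmod_ne_zero
      (a := (b : (Fin m → ℤ) ⧸ S)) (by simpa [QuotientAddGroup.eq_zero_iff] using hb)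
    obtain ⟨χ, hχ⟩ := exists_dotProduct_of_addMonoidHom (ψ.comp (QuotientAddGroup.mk' S))
    refine ⟨χ, q, fun s hs => ?_, fun h => hψ ?_⟩
    · rw [← ZMod.intCast_zmod_eq_zero_iff_dvd, ← hχ]
      simp [(QuotientAddGroup.eq_zero_iff s).2 hs]
    · rw [← ZMod.intCast_zmod_eq_zero_iff_dvd, ← hχ] at h
      exact h
  · rintro ⟨χ, q, hS, hb⟩ hbS
    exact hb (hS b hbS)

theorem notMem_gen_iff_exists_dvd {L : List (Multiplicative (Fin m → ℤ))}
    {b : Multiplicative (Fin m → ℤ)} :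
    b ∉ gen L ↔ ∃ (χ : Fin m → ℤ) (q : ℕ),
      (∀ s ∈ L, (q : ℤ) ∣ χ ⬝ᵥ s.toAdd) ∧ ¬ (q : ℤ) ∣ χ ⬝ᵥ b.toAdd := by
  refine (notMem_addSubgroup_iff_exists_dvd (S := (gen L).toAddSubgroup')
    (b := b.toAdd)).trans (exists₂_congr fun χ q => and_congr_left' ?_)
  let M : AddSubgroup (Fin m → ℤ) :=
    (AddSubgroup.zmultiples (q : ℤ)).comap (dotProductBilin ℤ ℤ χ).toAddMonoidHom
  have hM : ∀ s, s ∈ M.toSubgroup ↔ (q : ℤ) ∣ χ ⬝ᵥ s.toAdd := fun s =>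
    Int.mem_zmultiples_iff
  change (∀ s ∈ gen L, (q : ℤ) ∣ χ ⬝ᵥ s.toAdd) ↔ _
  simp only [← hM]
  exact gen_le_iff (L := L) (K := M.toSubgroup)

instance : SolvableMembership (Multiplicative (Fin m → ℤ)) where
  rePred_notMem := by
    refine REPred.of_eq ?_ fun _ => notMem_gen_iff_exists_dvd.symm
    refine rePred_exists (rePred_exists (rePred_and (rePred_ball ?_ (by fun_prop)) ?_))
    · exact rePred_of_primrecPred (primrecPred_natCast_dvd_int (by fun_prop) (by fun_prop))
    · exact rePred_of_primrecPred (primrecPred_natCast_dvd_int (by fun_prop) (by fun_prop)).not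

end AbelianMembership

section WeightedPermutations

variable {S Γ : Type*} [Group Γ]

/-- The permutations of `S × Γ` commuting with right multiplications of the weight. -/
def rightInvariant (S Γ : Type*) [Group Γ] : Subgroup (Equiv.Perm (S × Γ)) :=
  Subgroup.centralizer (Set.range fun g : Γ => Equiv.prodCongr (Equiv.refl S) (Equiv.mulRight g))

theorem apply_mul_of_mem_rightInvariant {f : Equiv.Perm (S × Γ)} (hf : f ∈ rightInvariant S Γ)
    (s : S) (c g : Γ) : f (s, c * g) = ((f (s, c)).1, (f (s, c)).2 * g) :=
  (DFunLike.congr_fun (hf _ ⟨g, rfl⟩) (s, c)).symm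

/-- The permutations of `S × Γ` multiplying the weight by elements of `H`. -/
def weightsIn (S : Type*) (H : Subgroup Γ) : Subgroup (Equiv.Perm (S × Γ)) where
  carrier := {f | ∀ x, (f x).2 ∈ H ↔ x.2 ∈ H}
  one_mem' _ := Iff.rfl
  mul_mem' hf hg x := (hf _).trans (hg x)
  inv_mem' {f} hf x := by simpa using (hf (f⁻¹ x)).symm

variable [DecidableEq S]

/-- The elementary weighted permutation given by `o = (p, q, c)`: it swaps the states `p` and `q`
and multiplies the weight by `c` at `p`. -/
def opPerm (o : S × S × Γ) : Equiv.Perm (S × Γ) where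
  toFun x := (Equiv.swap o.1 o.2.1 x.1, if x.1 = o.1 then o.2.2 * x.2 else x.2)
  invFun x := (Equiv.swap o.1 o.2.1 x.1, if x.1 = o.2.1 then o.2.2⁻¹ * x.2 else x.2)
  left_inv x := by
    rcases eq_or_ne x.1 o.1 with h | h
    · ext <;> simp [h]
    · have hswap : Equiv.swap o.1 o.2.1 x.1 ≠ o.2.1 := by
        rwa [Ne, Equiv.swap_apply_eq_iff, Equiv.swap_apply_right]
      ext <;> simp [h, hswap]
  right_inv x := by
    rcases eq_or_ne x.1 o.2.1 with h | h
    · ext <;> simp [h]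
    · have hswap : Equiv.swap o.1 o.2.1 x.1 ≠ o.1 := by
        rwa [Ne, Equiv.swap_apply_eq_iff, Equiv.swap_apply_left]
      ext <;> simp [h, hswap]

/-- The weighted permutation given by a list of elementary ones, the last one acting first. -/
def opsPerm (B : List (S × S × Γ)) : Equiv.Perm (S × Γ) := (B.map opPerm).prod

theorem opsPerm_cons (o : S × S × Γ) (B : List (S × S × Γ)) :
    opsPerm (o :: B) = opPerm o * opsPerm B := List.prod_cons

theorem opsPerm_apply (B : List (S × S × Γ)) (x : S × Γ) :
    opsPerm B x = B.foldr (fun o y => opPerm o y) x := by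
  induction B with
  | nil => rfl
  | cons o B ih => rw [opsPerm_cons, Equiv.Perm.mul_apply, ih, List.foldr_cons]

theorem opsPerm_symm_apply (B : List (S × S × Γ)) (x : S × Γ) :
    (opsPerm B).symm x = B.foldl (fun y o => (opPerm o).symm y) x := by
  induction B generalizing x with
  | nil => rfl
  | cons o B ih => rw [List.foldl_cons, ← ih, opsPerm_cons]; rfl

theorem opsPerm_mem {K : Subgroup (Equiv.Perm (S × Γ))} {B : List (S × S × Γ)}
    (hB : ∀ o ∈ B, opPerm o ∈ K) : opsPerm B ∈ K :=
  K.list_prod_mem (List.forall_mem_map.2 hB)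

theorem opPerm_mem_rightInvariant (o : S × S × Γ) : opPerm o ∈ rightInvariant S Γ := by
  rintro _ ⟨g, rfl⟩
  ext x
  · rfl
  · simp only [opPerm, Equiv.Perm.mul_apply, Equiv.coe_fn_mk, Equiv.prodCongr_apply, Prod.map,
      Equiv.refl_apply, Equiv.coe_mulRight]
    split_ifs
    · rw [mul_assoc]
    · rfl

theorem opPerm_mem_weightsIn {H : Subgroup Γ} {o : S × S × Γ} (ho : o.2.2 ∈ H) :
    opPerm o ∈ weightsIn S H := by
  intro x
  simp only [opPerm, Equiv.coe_fn_mk]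
  split_ifs
  · exact Subgroup.mul_mem_cancel_left _ ho
  · exact Iff.rfl

theorem exists_opsPerm_eq {ι : Type*} {H : Subgroup Γ} (T : Finset ι) {f h : ι → S}
    (hf : Set.InjOn f T) (hh : Set.InjOn h T) {c : ι → Γ} (hc : ∀ t ∈ T, c t ∈ H) :
    ∃ B : List (S × S × Γ), (∀ o ∈ B, o.2.2 ∈ H) ∧
      ∀ t ∈ T, ∀ g, opsPerm B (f t, g) = (h t, c t * g) := by
  classical
  induction T using Finset.induction_on with
  | empty => exact ⟨[], by simp, by simp⟩
  | insert a T ha ih =>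
    rw [Finset.coe_insert, Set.injOn_insert (by simpa using ha)] at hf hh
    rw [Finset.forall_mem_insert] at hc
    obtain ⟨B, hBH, hB⟩ := ih hf.1 hh.1 hc.2
    obtain ⟨s, d, hsd⟩ : ∃ s d, opsPerm B (f a, 1) = (s, d) := ⟨_, _, rfl⟩
    have hBa (g : Γ) : opsPerm B (f a, g) = (s, d * g) := by
      simpa [hsd] using apply_mul_of_mem_rightInvariant
        (opsPerm_mem (B := B) fun o _ => opPerm_mem_rightInvariant o) (f a) 1 g
    have hd : d ∈ H := by
      simpa [hsd] using opsPerm_mem (fun o ho => opPerm_mem_weightsIn (hBH o ho)) (f a, 1)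
    have hs : ∀ t ∈ T, h t ≠ s := by
      rintro t ht rfl
      have heq : opsPerm B (f t, (c t)⁻¹) = opsPerm B (f a, d⁻¹) := by simp [hB t ht, hBa]
      exact hf.2 ⟨t, ht, congrArg Prod.fst ((opsPerm B).injective heq)⟩
    have hne : ∀ t ∈ T, h t ≠ h a := fun t ht h' => hh.2 ⟨t, ht, h'⟩
    refine ⟨(s, h a, c a * d⁻¹) :: B, ?_, ?_⟩
    · exact List.forall_mem_cons.2 ⟨H.mul_mem hc.1 (H.inv_mem hd), hBH⟩
    · rw [Finset.forall_mem_insert]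
      refine ⟨fun g => ?_, fun t ht g => ?_⟩
      · simp [opsPerm_cons, hBa, opPerm, mul_assoc]
      · simp [opsPerm_cons, hB t ht, opPerm, hs t ht,
          Equiv.swap_apply_of_ne_of_ne (hs t ht) (hne t ht)]

end WeightedPermutations

section Automata

variable {n : ℕ} {S Γ : Type*} [DecidableEq S] [Group Γ]

/-- Weighted permutation automata over the alphabet `Fin n`: each letter acts on pairs (state,
weight) by a product of elementary weighted permutations. -/
abbrev WeightedAutomaton (n : ℕ) (S Γ : Type*) : Type _ := Fin n → List (S × S × Γ)

/-- The action of the free group on pairs (state, weight) defined by an automaton. -/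
def WeightedAutomaton.action (M : WeightedAutomaton n S Γ) :
    FreeGroup (Fin n) →* Equiv.Perm (S × Γ) :=
  FreeGroup.lift fun i => opsPerm (M i)

namespace WeightedAutomaton

theorem action_of (M : WeightedAutomaton n S Γ) (i : Fin n) :
    M.action (FreeGroup.of i) = opsPerm (M i) := FreeGroup.lift_apply_of ..

theorem action_mem {M : WeightedAutomaton n S Γ} {K : Subgroup (Equiv.Perm (S × Γ))}
    (hM : ∀ i, ∀ o ∈ M i, opPerm o ∈ K) (u : FreeGroup (Fin n)) : M.action u ∈ K := by
  refine FreeGroup.range_lift_le (s := K) ?_ ⟨u, rfl⟩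
  rintro _ ⟨i, rfl⟩
  exact opsPerm_mem (hM i)

theorem action_mul_right (M : WeightedAutomaton n S Γ) (u : FreeGroup (Fin n)) (s : S) (c g : Γ) :
    M.action u (s, c * g) = ((M.action u (s, c)).1, (M.action u (s, c)).2 * g) :=
  apply_mul_of_mem_rightInvariant (action_mem (fun _ o _ => opPerm_mem_rightInvariant o) u) s c g

theorem action_snd_mem {M : WeightedAutomaton n S Γ} {H : Subgroup Γ}
    (hM : ∀ i, ∀ o ∈ M i, o.2.2 ∈ H) (u : FreeGroup (Fin n)) (s : S) :
    (M.action u (s, 1)).2 ∈ H :=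
  (action_mem (fun i o ho => opPerm_mem_weightsIn (hM i o ho)) u (s, 1)).2 H.one_mem

theorem action_mk_apply (M : WeightedAutomaton n S Γ) (w : List (Fin n × Bool)) (x : S × Γ) :
    M.action (FreeGroup.mk w) x = w.foldr
      (fun l y => bif l.2 then opsPerm (M l.1) y else (opsPerm (M l.1)).symm y) x := by
  induction w with
  | nil => rfl
  | cons l w ih =>
    obtain ⟨i, _ | _⟩ := l
    · have hmk : FreeGroup.mk ((i, false) :: w) = (FreeGroup.of i)⁻¹ * FreeGroup.mk w := rfl
      rw [hmk, map_mul, map_inv, action_of, Equiv.Perm.mul_apply, ih]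
      rfl
    · have hmk : FreeGroup.mk ((i, true) :: w) = FreeGroup.of i * FreeGroup.mk w := rfl
      rw [hmk, map_mul, action_of, Equiv.Perm.mul_apply, ih]
      rfl

end WeightedAutomaton

variable {α : Type*} [Primcodable α] [Primcodable S] [Primcodable Γ] [PrimrecGroup Γ]

@[fun_prop]
theorem primrec_opPerm {o : α → S × S × Γ} {x : α → S × Γ} (ho : Primrec o) (hx : Primrec x) :
    Primrec fun a => opPerm (o a) (x a) := by
  simp only [opPerm, Equiv.coe_fn_mk, Equiv.swap_apply_def]
  exact Primrec.pair (Primrec.ite (Primrec.eq.comp (by fun_prop) (by fun_prop)) (by fun_prop)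
    (Primrec.ite (Primrec.eq.comp (by fun_prop) (by fun_prop)) (by fun_prop) (by fun_prop)))
    (Primrec.ite (Primrec.eq.comp (by fun_prop) (by fun_prop)) (by fun_prop) (by fun_prop))

@[fun_prop]
theorem primrec_opPerm_symm {o : α → S × S × Γ} {x : α → S × Γ} (ho : Primrec o)
    (hx : Primrec x) : Primrec fun a => (opPerm (o a)).symm (x a) := by
  simp only [opPerm, Equiv.coe_fn_symm_mk, Equiv.swap_apply_def]
  exact Primrec.pair (Primrec.ite (Primrec.eq.comp (by fun_prop) (by fun_prop)) (by fun_prop)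
    (Primrec.ite (Primrec.eq.comp (by fun_prop) (by fun_prop)) (by fun_prop) (by fun_prop)))
    (Primrec.ite (Primrec.eq.comp (by fun_prop) (by fun_prop)) (by fun_prop) (by fun_prop))

@[fun_prop]
theorem primrec_action {M : α → WeightedAutomaton n S Γ} {u : α → FreeGroup (Fin n)}
    {x : α → S × Γ} (hM : Primrec M) (hu : Primrec u) (hx : Primrec x) :
    Primrec fun a => (M a).action (u a) (x a) := by
  have hletter : Primrec fun z : α × (Fin n × Bool) × S × Γ => M z.1 z.2.1.1 :=
    Primrec.fin_app.comp (by fun_prop) (by fun_prop)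
  refine (primrec_foldr (f := fun a => (u a).toWord) (h := fun a l y =>
    bif l.2 then opsPerm (M a l.1) y else (opsPerm (M a l.1)).symm y)
    (by fun_prop) hx (Primrec.cond (by fun_prop) ?_ ?_)).of_eq fun a => ?_
  · simp only [opsPerm_apply]
    exact primrec_foldr hletter (by fun_prop) (by fun_prop)
  · simp only [opsPerm_symm_apply]
    have hstep : Primrec fun z : (α × (Fin n × Bool) × S × Γ) × (S × Γ) × (S × S × Γ) =>
        (opPerm z.2.2).symm z.2.1 := by fun_prop
    exact Primrec.list_foldl hletter (by fun_prop) hstep.to₂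
  · rw [← WeightedAutomaton.action_mk_apply, FreeGroup.mk_toWord]

end Automata

section CertificateExistence

theorem exists_section_quotient {G : Type*} [Group G] (P : Subgroup G) :
    ∃ r : G ⧸ P → G, r ↑(1 : G) = 1 ∧ ∀ ω, (r ω : G ⧸ P) = ω := by
  classical
  refine ⟨Function.update Quotient.out ↑(1 : G) 1, Function.update_self .., fun ω => ?_⟩
  rcases eq_or_ne ω ↑(1 : G) with rfl | hω
  · rw [Function.update_self]
  · rw [Function.update_of_ne hω]
    exact Quotient.out_eq ω

variable {n : ℕ} {A : Type*} [Group A] {P : Subgroup (FreeGroup (Fin n))}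
  {r : FreeGroup (Fin n) ⧸ P → FreeGroup (Fin n)} {V : Finset (FreeGroup (Fin n) ⧸ P)}

/-- On the finite set `V` of vertices, `M` is the Schreier coset graph of `P`: vertices are
represented by the section `r`, and the free part of the weight of an edge is the Schreier generator
attached to that edge. -/
def IsSchreierAutomaton (M : WeightedAutomaton n (FreeGroup (Fin n)) (FreeGroup (Fin n) × A))
    (r : FreeGroup (Fin n) ⧸ P → FreeGroup (Fin n)) (V : Finset (FreeGroup (Fin n) ⧸ P)) : Prop :=
  ∀ i, ∀ ω ∈ V, ∃ c : FreeGroup (Fin n) × A,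
    r (FreeGroup.of i • ω) * c.1 = FreeGroup.of i * r ω ∧
      ∀ g, M.action (FreeGroup.of i) (r ω, g) = (r (FreeGroup.of i • ω), c * g)

theorem exists_isSchreierAutomaton {H : Subgroup (FreeGroup (Fin n) × A)}
    (hP : P ≤ H.map (MonoidHom.fst _ _)) (hr : ∀ ω, (r ω : FreeGroup (Fin n) ⧸ P) = ω)
    (V : Finset (FreeGroup (Fin n) ⧸ P)) :
    ∃ M : WeightedAutomaton n (FreeGroup (Fin n)) (FreeGroup (Fin n) × A),
      (∀ i, ∀ o ∈ M i, o.2.2 ∈ H) ∧ IsSchreierAutomaton M r V := by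
  have hlift : ∀ i ω, ∃ c ∈ H, r (FreeGroup.of i • ω) * c.1 = FreeGroup.of i * r ω := by
    intro i ω
    have hmem : (r (FreeGroup.of i • ω))⁻¹ * (FreeGroup.of i * r ω) ∈ P := by
      rw [← QuotientGroup.eq, hr]
      conv_lhs => rw [← hr ω]
      rfl
    obtain ⟨c, hc, hcr⟩ := hP hmem
    exact ⟨c, hc, by rw [← eq_inv_mul_iff_mul_eq]; exact hcr⟩
  choose c hcH hc using hlift
  have hinj : Function.Injective r := fun ω ω' h => by rw [← hr ω, ← hr ω', h]
  have hops (i : Fin n) := exists_opsPerm_eq V hinj.injOn (h := fun ω => r (FreeGroup.of i • ω))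
    (hinj.comp (MulAction.injective (FreeGroup.of i))).injOn (c := c i) fun ω _ => hcH i ω
  choose M hMH hM using hops
  refine ⟨M, hMH, fun i ω hω => ⟨c i ω, hc i ω, fun g => ?_⟩⟩
  rw [WeightedAutomaton.action_of]
  exact hM i ω hω g

variable {M : WeightedAutomaton n (FreeGroup (Fin n)) (FreeGroup (Fin n) × A)}

theorem exists_action_letter_eq (hM : IsSchreierAutomaton M r V) {l : Fin n × Bool}
    {ω : FreeGroup (Fin n) ⧸ P} (hω : ω ∈ V) (hl : FreeGroup.mk [l] • ω ∈ V)
    (g : FreeGroup (Fin n) × A) :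
    ∃ g' : FreeGroup (Fin n) × A,
      M.action (FreeGroup.mk [l]) (r ω, g) = (r (FreeGroup.mk [l] • ω), g') ∧
        r (FreeGroup.mk [l] • ω) * g'.1 = FreeGroup.mk [l] * (r ω * g.1) := by
  obtain ⟨i, _ | _⟩ := l
  · have hmk : FreeGroup.mk [(i, false)] = (FreeGroup.of i)⁻¹ := rfl
    rw [hmk] at hl ⊢
    obtain ⟨c, hc, hcM⟩ := hM i _ hl
    rw [smul_inv_smul] at hc hcM
    refine ⟨c⁻¹ * g, ?_, ?_⟩
    · rw [map_inv, Equiv.Perm.inv_eq_iff_eq, hcM, mul_inv_cancel_left]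
    · rw [eq_inv_mul_iff_mul_eq, ← mul_assoc, ← hc]
      simp [mul_assoc]
  · have hmk : FreeGroup.mk [(i, true)] = FreeGroup.of i := rfl
    rw [hmk]
    obtain ⟨c, hc, hcM⟩ := hM i _ hω
    exact ⟨c * g, hcM g, by rw [Prod.fst_mul, ← mul_assoc, hc, mul_assoc]⟩

theorem exists_action_mk_eq (hr1 : r ↑(1 : FreeGroup (Fin n)) = 1)
    (hM : IsSchreierAutomaton M r V) {w : List (Fin n × Bool)}
    (hw : ∀ s, s <:+ w → ↑(FreeGroup.mk s) ∈ V) :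
    ∃ g : FreeGroup (Fin n) × A, M.action (FreeGroup.mk w) (1, 1) = (r ↑(FreeGroup.mk w), g) ∧
      r ↑(FreeGroup.mk w) * g.1 = FreeGroup.mk w := by
  induction w with
  | nil =>
    rw [← FreeGroup.one_eq_mk, map_one, hr1]
    exact ⟨1, rfl, mul_one 1⟩
  | cons l w ih =>
    obtain ⟨g, hg, hgw⟩ := ih fun s hs => hw s (hs.trans (List.suffix_cons l w))
    obtain ⟨g', hg', hgl⟩ := exists_action_letter_eq hM (hw w (List.suffix_cons l w))
      (hw (l :: w) List.suffix_rfl) g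
    refine ⟨g', ?_, hgl.trans (by rw [hgw]; rfl)⟩
    have hmk : FreeGroup.mk (l :: w) = FreeGroup.mk [l] * FreeGroup.mk w := rfl
    rw [hmk, map_mul, Equiv.Perm.mul_apply, hg, hg']
    rfl

end CertificateExistence

section Certificates

variable {n : ℕ} {A : Type*} [CommGroup A]

/-- `M` certifies membership in the subgroup generated by `L`: its weights lie in that subgroup,
and reading the free part of a generator leads back to the initial state `1` with a weight having
the same free part. -/
structure IsCert (M : WeightedAutomaton n (FreeGroup (Fin n)) (FreeGroup (Fin n) × A))
    (L : List (FreeGroup (Fin n) × A)) : Prop where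
  weight_mem : ∀ i, ∀ o ∈ M i, o.2.2 ∈ gen L
  state_eq : ∀ y ∈ L, (M.action y.1 (1, 1)).1 = 1
  weight_fst_eq : ∀ y ∈ L, (M.action y.1 (1, 1)).2.1 = y.1

theorem exists_isCert (L : List (FreeGroup (Fin n) × A)) :
    ∃ M : WeightedAutomaton n (FreeGroup (Fin n)) (FreeGroup (Fin n) × A), IsCert M L := by
  classical
  obtain ⟨r, hr1, hr⟩ := exists_section_quotient ((gen L).map (MonoidHom.fst _ _))
  obtain ⟨M, hMH, hM⟩ := exists_isSchreierAutomaton le_rfl hr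
    (L.flatMap fun y => y.1.toWord.tails.map fun s => ↑(FreeGroup.mk s)).toFinset
  have hrun : ∀ y ∈ L, ∃ g : FreeGroup (Fin n) × A, M.action y.1 (1, 1) = (1, g) ∧ g.1 = y.1 := by
    intro y hy
    obtain ⟨g, hg, hgy⟩ := exists_action_mk_eq hr1 hM (w := y.1.toWord) fun s hs => by
      simp only [List.mem_toFinset, List.mem_flatMap, List.mem_map, List.mem_tails]
      exact ⟨y, hy, s, hs, rfl⟩
    have hone : (y.1 : FreeGroup (Fin n) ⧸ (gen L).map (MonoidHom.fst _ _)) =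
        ↑(1 : FreeGroup (Fin n)) := by
      rw [eq_comm, QuotientGroup.eq, inv_one, one_mul]
      exact ⟨y, mem_gen_of_mem hy, rfl⟩
    rw [FreeGroup.mk_toWord, hone, hr1] at hg hgy
    exact ⟨g, hg, by rwa [one_mul] at hgy⟩
  refine ⟨M, hMH, fun y hy => ?_, fun y hy => ?_⟩
  all_goals
    obtain ⟨g, hg, hgy⟩ := hrun y hy
    rw [hg]
  exact hgy

/-- Generators of the intersection with `A` of the subgroup generated by `L`, for a certificate
`M`. -/
def kernelGens (M : WeightedAutomaton n (FreeGroup (Fin n)) (FreeGroup (Fin n) × A))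
    (L : List (FreeGroup (Fin n) × A)) : List A :=
  L.map fun y => y.2 * (M.action y.1 (1, 1)).2.2⁻¹

/-- The elements `g` whose free part is accepted by `M` with a weight which differs from `g` by an
element of `Z ≤ A`. -/
def acceptedSubgroup (M : WeightedAutomaton n (FreeGroup (Fin n)) (FreeGroup (Fin n) × A))
    (Z : Subgroup A) : Subgroup (FreeGroup (Fin n) × A) where
  carrier := {g | (M.action g.1 (1, 1)).1 = 1 ∧ (M.action g.1 (1, 1)).2.1 = g.1 ∧
    g.2 * (M.action g.1 (1, 1)).2.2⁻¹ ∈ Z}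
  one_mem' := by simp
  mul_mem' := by
    rintro x y ⟨hx, hx1, hxZ⟩ ⟨hy, hy1, hyZ⟩
    have hxy : M.action (x.1 * y.1) (1, 1) =
        (1, (M.action x.1 (1, 1)).2 * (M.action y.1 (1, 1)).2) := by
      rw [map_mul, Equiv.Perm.mul_apply, ← Prod.mk.eta (p := M.action y.1 (1, 1)), hy,
        ← one_mul (M.action y.1 (1, 1)).2, M.action_mul_right, hx, one_mul]
    simp only [Set.mem_ofPred_eq, Prod.fst_mul, Prod.snd_mul, hxy, hx1, hy1, mul_inv, true_and]
    rw [mul_mul_mul_comm]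
    exact Z.mul_mem hxZ hyZ
  inv_mem' := by
    rintro x ⟨hx, hx1, hxZ⟩
    have hinv : M.action x.1⁻¹ (1, 1) = (1, (M.action x.1 (1, 1)).2⁻¹) := by
      rw [map_inv, Equiv.Perm.inv_eq_iff_eq, ← one_mul (M.action x.1 (1, 1)).2⁻¹,
        M.action_mul_right, hx, mul_inv_cancel]
    simp only [Set.mem_ofPred_eq, Prod.fst_inv, Prod.snd_inv, hinv, hx1, true_and]
    rw [← mul_inv]
    exact Z.inv_mem hxZ

variable {M : WeightedAutomaton n (FreeGroup (Fin n)) (FreeGroup (Fin n) × A)}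
  {L : List (FreeGroup (Fin n) × A)}

theorem IsCert.gen_eq (hM : IsCert M L) : gen L = acceptedSubgroup M (gen (kernelGens M L)) := by
  refine le_antisymm (gen_le_iff.2 fun y hy => ⟨hM.state_eq y hy, hM.weight_fst_eq y hy,
    mem_gen_of_mem (List.mem_map.2 ⟨y, hy, rfl⟩)⟩) fun g ⟨_, hg, hgZ⟩ => ?_
  have hweight (u : FreeGroup (Fin n)) : (M.action u (1, 1)).2 ∈ gen L :=
    WeightedAutomaton.action_snd_mem hM.weight_mem u 1
  have hkernel : gen (kernelGens M L) ≤ (gen L).comap (MonoidHom.inr _ _) := by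
    refine gen_le_iff.2 (List.forall_mem_map.2 fun y hy => ?_)
    have hy' : MonoidHom.inr (FreeGroup (Fin n)) A (y.2 * (M.action y.1 (1, 1)).2.2⁻¹) =
        y * (M.action y.1 (1, 1)).2⁻¹ := Prod.ext (by simp [hM.weight_fst_eq y hy]) rfl
    rw [Subgroup.mem_comap, hy']
    exact (gen L).mul_mem (mem_gen_of_mem hy) ((gen L).inv_mem (hweight y.1))
  have hg' : MonoidHom.inr (FreeGroup (Fin n)) A (g.2 * (M.action g.1 (1, 1)).2.2⁻¹) *
      (M.action g.1 (1, 1)).2 = g := Prod.ext (by simp [hg]) (by simp)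
  rw [← hg']
  exact (gen L).mul_mem (hkernel hgZ) (hweight g.1)

theorem IsCert.comap_inr_gen (hM : IsCert M L) :
    (gen L).comap (MonoidHom.inr _ _) = gen (kernelGens M L) := by
  ext a
  rw [hM.gen_eq]
  simp [acceptedSubgroup, Subgroup.mem_comap]

end Certificates

section Decidability

variable {n : ℕ} {α A : Type*} [Primcodable α] [CommGroup A] [Primcodable A] [PrimrecGroup A]

@[fun_prop]
theorem primrec_kernelGens
    {M : α → WeightedAutomaton n (FreeGroup (Fin n)) (FreeGroup (Fin n) × A)}
    {L : α → List (FreeGroup (Fin n) × A)} (hM : Primrec M) (hL : Primrec L) :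
    Primrec fun a => kernelGens (M a) (L a) := by
  unfold kernelGens
  fun_prop

@[fun_prop]
theorem rePred_isCert {M : α → WeightedAutomaton n (FreeGroup (Fin n)) (FreeGroup (Fin n) × A)}
    {L : α → List (FreeGroup (Fin n) × A)} (hM : Primrec M) (hL : Primrec L) :
    REPred fun a => IsCert (M a) (L a) := by
  have hweight : REPred fun a => ∀ i ∈ List.finRange n, ∀ o ∈ M a i, o.2.2 ∈ gen (L a) :=
    rePred_ball (rePred_ball (by fun_prop) (Primrec.fin_app.comp (by fun_prop) (by fun_prop)))
      (by fun_prop)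
  refine REPred.of_eq (rePred_and hweight (rePred_and (q := fun a =>
    ∀ y ∈ L a, ((M a).action y.1 (1, 1)).2.1 = y.1) (p := fun a =>
    ∀ y ∈ L a, ((M a).action y.1 (1, 1)).1 = 1) (by fun_prop) (by fun_prop))) fun a => ?_
  simp only [List.mem_finRange, forall_const]
  exact ⟨fun h => ⟨h.1, h.2.1, h.2.2⟩, fun h => ⟨h.1, h.2, h.3⟩⟩

instance [SolvableMembership A] : SolvableMembership (FreeGroup (Fin n) × A) where
  rePred_notMem := by
    refine REPred.of_eq (p := fun x : List (FreeGroup (Fin n) × A) × FreeGroup (Fin n) × A =>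
      ∃ M : WeightedAutomaton n (FreeGroup (Fin n)) (FreeGroup (Fin n) × A), IsCert M x.1 ∧
        ((M.action x.2.1 (1, 1)).1 ≠ 1 ∨ (M.action x.2.1 (1, 1)).2.1 ≠ x.2.1 ∨
          x.2.2 * (M.action x.2.1 (1, 1)).2.2⁻¹ ∉ gen (kernelGens M x.1))) (by fun_prop)
      fun x => ?_
    have hiff (M : WeightedAutomaton n (FreeGroup (Fin n)) (FreeGroup (Fin n) × A))
        (hM : IsCert M x.1) : x.2 ∉ gen x.1 ↔ ((M.action x.2.1 (1, 1)).1 ≠ 1 ∨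
          (M.action x.2.1 (1, 1)).2.1 ≠ x.2.1 ∨
          x.2.2 * (M.action x.2.1 (1, 1)).2.2⁻¹ ∉ gen (kernelGens M x.1)) := by
      rw [hM.gen_eq, ← not_and_or, ← not_and_or]
      rfl
    constructor
    · rintro ⟨M, hM, h⟩
      exact (hiff M hM).2 h
    · intro h
      obtain ⟨M, hM⟩ := exists_isCert x.1
      exact ⟨M, hM, (hiff M hM).1 h⟩

instance : SolvableMembership (FreeGroup (Fin n)) :=
  SolvableMembership.of_injective
    (f := MonoidHom.inl (FreeGroup (Fin n)) (Multiplicative (Fin 0 → ℤ)))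
    (fun _ _ h => congrArg Prod.fst h) (Primrec.pair Primrec.id (Primrec.const 1))

theorem fg_comap_inr_gen {A : Type*} [CommGroup A] (L : List (FreeGroup (Fin n) × A)) :
    ((gen L).comap (MonoidHom.inr _ _)).FG := by
  obtain ⟨M, hM⟩ := exists_isCert L
  exact hM.comap_inr_gen ▸ fg_gen _

@[fun_prop]
theorem rePred_gen_eq_comap_inr [SolvableMembership A] {Z : α → List A}
    {L : α → List (FreeGroup (Fin n) × A)} (hZ : Primrec Z) (hL : Primrec L) :
    REPred fun a => gen (Z a) = (gen (L a)).comap (MonoidHom.inr _ _) := by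
  refine REPred.of_eq (p := fun a => ∃ M, IsCert M (L a) ∧ gen (Z a) ≤ gen (kernelGens M (L a)) ∧
    gen (kernelGens M (L a)) ≤ gen (Z a)) (by fun_prop) fun a => ?_
  constructor
  · rintro ⟨M, hM, hle, hge⟩
    rw [hM.comap_inr_gen, le_antisymm hle hge]
  · intro h
    obtain ⟨M, hM⟩ := exists_isCert (L a)
    rw [h, hM.comap_inr_gen]
    exact ⟨M, hM, le_rfl, le_rfl⟩

end Decidability

section CosetCovers

variable {α G : Type*} [Primcodable α] [Group G]

/-- The list `T` consists of elements of `P` and meets every coset `Q g` with `g ∈ P`. -/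
def IsCosetCover (P Q : Subgroup G) (T : List G) : Prop :=
  (∀ t ∈ T, t ∈ P) ∧ ∀ g ∈ P, ∃ t ∈ T, g * t⁻¹ ∈ Q

/-- It suffices to test that `T` is stable under right multiplication by generators. -/
theorem isCosetCover_gen_iff {L T : List G} {Q : Subgroup G} :
    IsCosetCover (gen L) Q T ↔ (∀ t ∈ T, t ∈ gen L) ∧ (∃ t ∈ T, t ∈ Q) ∧
      ∀ t ∈ T, ∀ y ∈ L, (∃ t' ∈ T, t * y * t'⁻¹ ∈ Q) ∧ ∃ t' ∈ T, t * y⁻¹ * t'⁻¹ ∈ Q := by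
  refine and_congr_right fun hTL => ⟨fun h => ⟨?_, fun t ht y hy => ?_⟩, ?_⟩
  · obtain ⟨t, ht, htQ⟩ := h 1 (one_mem _)
    exact ⟨t, ht, by simpa using htQ⟩
  · exact ⟨h _ (mul_mem (hTL t ht) (mem_gen_of_mem hy)),
      h _ (mul_mem (hTL t ht) (inv_mem (mem_gen_of_mem hy)))⟩
  · rintro ⟨⟨t₀, ht₀, ht₀Q⟩, hstep⟩ g hg
    have hchain : ∀ {x y t t' : G}, x * t⁻¹ ∈ Q → t * y * t'⁻¹ ∈ Q → x * y * t'⁻¹ ∈ Q :=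
      fun hx hy => by simpa [mul_assoc] using mul_mem hx hy
    induction hg using Subgroup.closure_induction_right with
    | one => exact ⟨t₀, ht₀, by simpa using ht₀Q⟩
    | mul_right x _ y hy ih =>
      obtain ⟨t, ht, hxt⟩ := ih
      obtain ⟨t', ht', hyt⟩ := (hstep t ht y hy).1
      exact ⟨t', ht', hchain hxt hyt⟩
    | mul_inv_cancel x _ y hy ih =>
      obtain ⟨t, ht, hxt⟩ := ih
      obtain ⟨t', ht', hyt⟩ := (hstep t ht y hy).2
      exact ⟨t', ht', hchain hxt hyt⟩

@[fun_prop]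
theorem rePred_isCosetCover [Primcodable G] [PrimrecGroup G] {L W T : α → List G}
    (hL : Primrec L) (hW : Primrec W) (hT : Primrec T) :
    REPred fun a => IsCosetCover (gen (L a)) (gen (W a)) (T a) := by
  simp only [isCosetCover_gen_iff]
  fun_prop

theorem exists_isCosetCover {P Q : Subgroup G} [Q.IsFiniteRelIndex P] :
    ∃ T, IsCosetCover P Q T ∧ T.Pairwise fun t t' => t * t'⁻¹ ∉ Q := by
  classical
  have := Fintype.ofFinite (P ⧸ Q.subgroupOf P)
  have hout : ∀ g : P, ((g : P ⧸ Q.subgroupOf P).out : G)⁻¹ * g ∈ Q := fun g =>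
    Subgroup.mem_subgroupOf.1 (QuotientGroup.eq.1 (Quotient.out_eq (g : P ⧸ Q.subgroupOf P)))
  refine ⟨Finset.univ.toList.map fun q : P ⧸ Q.subgroupOf P => (q.out : G)⁻¹, ⟨?_, ?_⟩, ?_⟩
  · simp
  · intro g hg
    refine ⟨_, List.mem_map_of_mem (a := ((⟨g, hg⟩⁻¹ : P) : P ⧸ Q.subgroupOf P)) (by simp), ?_⟩
    simpa using inv_mem (hout ⟨g, hg⟩⁻¹)
  · rw [List.pairwise_map]
    refine (Finset.nodup_toList _).imp fun {q q'} hne h => hne ?_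
    rw [← Quotient.out_eq q, ← Quotient.out_eq q']
    exact QuotientGroup.eq.2 (Subgroup.mem_subgroupOf.2 (by simpa using h))

theorem fg_of_isFiniteRelIndex {P Q : Subgroup G} (hP : P.FG) (hQP : Q ≤ P)
    [Q.IsFiniteRelIndex P] : Q.FG := by
  have : Group.FG P := (Group.fg_iff_subgroup_fg P).2 hP
  have hfg : (Q.subgroupOf P).FG :=
    (Group.fg_iff_subgroup_fg _).1 (Subgroup.fg_of_index_ne_zero _)
  obtain ⟨W, hW⟩ := exists_gen_eq hfg
  rw [← inf_eq_left.2 hQP, ← Subgroup.subgroupOf_map_subtype, ← hW, ← gen_map]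
  exact fg_gen _

theorem gen_eq_iff_exists_isCosetCover {L W : List G} {Q : Subgroup G} (hQ : Q ≤ gen L)
    [Q.IsFiniteRelIndex (gen L)] :
    gen W = Q ↔ (∀ w ∈ W, w ∈ Q) ∧
      ∃ T, IsCosetCover (gen L) (gen W) T ∧ ∀ t ∈ T, t ∉ Q ∨ t ∈ gen W := by
  constructor
  · rintro rfl
    obtain ⟨T, hT, -⟩ := exists_isCosetCover (P := gen L) (Q := gen W)
    exact ⟨fun w => mem_gen_of_mem, T, hT, fun t _ => (em _).symm⟩
  · rintro ⟨hWQ, T, hT, hTQ⟩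
    have hle : gen W ≤ Q := gen_le_iff.2 hWQ
    refine hle.antisymm fun g hg => ?_
    obtain ⟨t, ht, hgt⟩ := hT.2 g (hQ hg)
    have htQ : t ∈ Q := by simpa using mul_mem (inv_mem (hle hgt)) hg
    have htW : t ∈ gen W := (hTQ t ht).resolve_left (not_not.2 htQ)
    simpa using mul_mem hgt htW

end CosetCovers

section Scaling

variable {G A : Type*} [Group G] [CommGroup A]

/-- The endomorphism `(u, a) ↦ (u, a ^ k)` of `G × A`. -/
def scaleHom (k : ℕ) : G × A →* G × A := (MonoidHom.id G).prodMap (powMonoidHom k)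

theorem scaleHom_apply (k : ℕ) (x : G × A) : scaleHom k x = (x.1, x.2 ^ k) := rfl

theorem mem_range_scaleHom {k : ℕ} {x : G × A} :
    x ∈ (scaleHom k : G × A →* G × A).range ↔ ∃ b, b ^ k = x.2 :=
  ⟨fun ⟨y, hy⟩ => ⟨y.2, congrArg Prod.snd hy⟩, fun ⟨b, hb⟩ => ⟨(x.1, b), Prod.ext rfl hb⟩⟩

theorem scaleHom_injective [IsMulTorsionFree A] {k : ℕ} (hk : 0 < k) :
    Function.Injective (scaleHom k : G × A →* G × A) :=
  Function.Injective.prodMap Function.injective_id (pow_left_injective hk.ne')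

theorem finiteIndex_range_scaleHom [Group.FG A] {k : ℕ} (hk : 0 < k) :
    (scaleHom k : G × A →* G × A).range.FiniteIndex := by
  have : (powMonoidHom k : A →* A).range.FiniteIndex :=
    Subgroup.finiteIndex_range_powMonoidHom_of_fg A hk.ne'
  have hrange : (scaleHom k : G × A →* G × A).range =
      (powMonoidHom k : A →* A).range.comap (MonoidHom.snd G A) :=
    Subgroup.ext fun x => mem_range_scaleHom
  rw [hrange]
  exact ⟨by
    rw [Subgroup.index_comap_of_surjective _ Prod.snd_surjective]
    exact Subgroup.FiniteIndex.index_ne_zero⟩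

theorem isFiniteRelIndex_range_scaleHom_inf [Group.FG A] (P : Subgroup (G × A)) {k : ℕ}
    (hk : 0 < k) : ((scaleHom k).range ⊓ P).IsFiniteRelIndex P := by
  have := finiteIndex_range_scaleHom (G := G) (A := A) hk
  exact ⟨by rw [Subgroup.inf_relIndex_right]; exact Subgroup.FiniteIndex.index_ne_zero⟩

theorem gen_eq_comap_scaleHom_iff [IsMulTorsionFree A] [Group.FG A] {W L : List (G × A)} {k : ℕ}
    (hk : 0 < k) : gen W = (gen L).comap (scaleHom k) ↔ (∀ w ∈ W, scaleHom k w ∈ gen L) ∧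
      ∃ T, IsCosetCover (gen L) (gen (W.map (scaleHom k))) T ∧
        ∀ t ∈ T, t ∉ (scaleHom k).range ∨ t ∈ gen (W.map (scaleHom k)) := by
  have := isFiniteRelIndex_range_scaleHom_inf (gen L) hk
  rw [← (Subgroup.map_injective (scaleHom_injective hk)).eq_iff, Subgroup.map_comap_eq, ← gen_map,
    gen_eq_iff_exists_isCosetCover inf_le_right]
  simp only [List.forall_mem_map, Subgroup.mem_inf, MonoidHom.mem_range, exists_apply_eq_apply,
    true_and]
  refine and_congr_right fun _ => exists_congr fun T => and_congr_right fun hT =>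
    forall₂_congr fun t ht => ?_
  simp only [hT.1 t ht, and_true]

theorem fg_comap_scaleHom [IsMulTorsionFree A] [Group.FG A] (L : List (G × A)) {k : ℕ}
    (hk : 0 < k) : ((gen L).comap (scaleHom k)).FG := by
  have := isFiniteRelIndex_range_scaleHom_inf (gen L) hk
  have hfg := fg_of_isFiniteRelIndex (fg_gen L) (inf_le_right : (scaleHom k).range ⊓ gen L ≤ _)
  rw [← Subgroup.map_comap_eq, ← Group.fg_iff_subgroup_fg] at hfg
  let e := ((gen L).comap (scaleHom k)).equivMapOfInjective _ (scaleHom_injective hk)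
  exact (Group.fg_iff_subgroup_fg _).1
    (Group.fg_of_surjective (f := e.symm.toMonoidHom) e.symm.surjective)

variable {α : Type*} [Primcodable α] [Primcodable G] {m : ℕ}

theorem exists_pow_eq_iff_forall_dvd {k : ℕ} {a : Multiplicative (Fin m → ℤ)} :
    (∃ b, b ^ k = a) ↔ ∀ i, (k : ℤ) ∣ a.toAdd i := by
  constructor
  · rintro ⟨b, rfl⟩ i
    exact ⟨b.toAdd i, by simp⟩
  · intro h
    choose b hb using h
    exact ⟨Multiplicative.ofAdd b, Multiplicative.toAdd.injective (funext fun i => by simp [hb])⟩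

@[fun_prop]
theorem primrec_scaleHom {f : α → G × Multiplicative (Fin m → ℤ)} {k : α → ℕ}
    (hf : Primrec f) (hk : Primrec k) : Primrec fun a => scaleHom (k a) (f a) := by
  simp only [scaleHom_apply]
  fun_prop

@[fun_prop]
theorem rePred_notMem_range_scaleHom {x : α → G × Multiplicative (Fin m → ℤ)} {k : α → ℕ}
    (hx : Primrec x) (hk : Primrec k) : REPred fun a => x a ∉ (scaleHom (k a)).range := by
  simp only [mem_range_scaleHom, exists_pow_eq_iff_forall_dvd, not_forall]
  refine rePred_exists (rePred_of_primrecPred (PrimrecPred.not ?_))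
  exact primrecPred_natCast_dvd_int (by fun_prop) (primrec_vec_apply (by fun_prop) (by fun_prop))

@[fun_prop]
theorem rePred_gen_eq_comap_scaleHom [PrimrecGroup G]
    {W L : α → List (G × Multiplicative (Fin m → ℤ))} {k : α → ℕ} (hk₀ : ∀ a, 0 < k a)
    (hW : Primrec W) (hL : Primrec L) (hk : Primrec k) :
    REPred fun a => gen (W a) = (gen (L a)).comap (scaleHom (k a)) := by
  simp only [gen_eq_comap_scaleHom_iff (hk₀ _)]
  fun_prop

end Scaling

section Tracing

open FreeGroup

variable {X Ω : Type*} [MulAction (FreeGroup X) Ω] {V : Set Ω} {ω : Ω} {w z : List (X × Bool)}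

/-- The path labelled `w` which starts at `ω` stays in `V`. A letter `x` leads from a vertex `ω`
to `x⁻¹ • ω`, so that the path labelled `w` ends at `(mk w)⁻¹ • ω`. -/
def Traces (V : Set Ω) (ω : Ω) (w : List (X × Bool)) : Prop :=
  ∀ i, (mk (w.take i))⁻¹ • ω ∈ V

theorem mk_append_inv_smul : (mk (w ++ z))⁻¹ • ω = (mk z)⁻¹ • (mk w)⁻¹ • ω := by
  rw [← mul_mk, mul_inv_rev, mul_smul]

theorem traces_append : Traces V ω (w ++ z) ↔ Traces V ω w ∧ Traces V ((mk w)⁻¹ • ω) z := by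
  constructor
  · refine fun h => ⟨fun i => ?_, fun i => ?_⟩
    · rcases le_total i w.length with hi | hi
      · simpa [List.take_append_of_le_length hi] using h i
      · simpa [List.take_of_length_le hi] using h w.length
    · have hi := h (w.length + i)
      rwa [List.take_length_add_append, mk_append_inv_smul] at hi
  · rintro ⟨hw, hz⟩ i
    rcases le_total i w.length with hi | hi
    · rw [List.take_append_of_le_length hi]
      exact hw i
    · obtain ⟨j, rfl⟩ := Nat.exists_eq_add_of_le hi
      rw [List.take_length_add_append, mk_append_inv_smul]
      exact hz j

theorem Traces.start_mem (h : Traces V ω w) : ω ∈ V := by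
  simpa [← one_eq_mk] using h 0

theorem Traces.end_mem (h : Traces V ω w) : (mk w)⁻¹ • ω ∈ V := by
  simpa using h w.length

theorem traces_nil (hω : ω ∈ V) : Traces V ω ([] : List (X × Bool)) := fun i => by
  simpa [← one_eq_mk] using hω

theorem Traces.invRev (h : Traces V ω w) : Traces V ((mk w)⁻¹ • ω) (invRev w) := by
  intro i
  have htake : (FreeGroup.invRev w).take i = FreeGroup.invRev (w.drop (w.length - i)) := by
    rw [FreeGroup.invRev, FreeGroup.invRev, List.take_reverse, List.length_map, List.map_drop]
  have hmk : (mk (w.drop (w.length - i))) * (mk w)⁻¹ = (mk (w.take (w.length - i)))⁻¹ := by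
    rw [mul_inv_eq_iff_eq_mul, eq_inv_mul_iff_mul_eq, mul_mk, List.take_append_drop]
  rw [htake, ← inv_mk, inv_inv, smul_smul, hmk]
  exact h _

theorem Traces.of_red (h : Traces V ω w) (hr : Red w z) : Traces V ω z := by
  induction hr with
  | refl => exact h
  | tail _ hs ih =>
    cases hs with
    | @not L₁ L₂ x c =>
      have hcancel : mk [(x, c), (x, !c)] = 1 := Quot.sound (Red.Step.not (L₁ := []) (L₂ := []))
      have ih' : Traces V ω (L₁ ++ ([(x, c), (x, !c)] ++ L₂)) := by simpa using ih
      rw [traces_append, traces_append, hcancel, inv_one, one_smul] at ih'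
      exact traces_append.2 ⟨ih'.1, ih'.2.2⟩

theorem Traces.of_flatten_replicate {k : ℕ} (h : Traces V ω (List.replicate k w).flatten) :
    ∀ i < k, Traces V ((mk w ^ i)⁻¹ • ω) w := by
  induction k generalizing ω with
  | zero => simp
  | succ k ih =>
    rw [List.replicate_succ, List.flatten_cons, traces_append] at h
    rintro (_ | i) hi
    · simpa using h.1
    · rw [pow_succ', mul_inv_rev, mul_smul]
      exact ih h.2 i (by omega)

variable [DecidableEq X]

/-- A shortest path in a finite set does not visit a vertex twice. -/
theorem Traces.exists_norm_le {V : Finset Ω} (h : Traces V ω w) :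
    ∃ x : FreeGroup X, x.norm ≤ V.card ∧ x⁻¹ • ω = (mk w)⁻¹ • ω := by
  induction hlen : w.length using Nat.strong_induction_on generalizing w with
  | _ N ih =>
    subst hlen
    by_cases hw : w.length ≤ V.card
    · exact ⟨mk w, norm_mk_le.trans hw, rfl⟩
    obtain ⟨i, hi, j, hj, hij, hloop⟩ := Finset.exists_ne_map_eq_of_card_lt_of_maps_to
      (s := Finset.range (V.card + 1)) (t := V) (by simp)
      (f := fun i => (mk (w.take i))⁻¹ • ω) (fun i _ => h i)
    wlog hlt : i < j generalizing i j
    · exact this j hj i hi hij.symm hloop.symm (by omega)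
    rw [Finset.mem_range] at hi hj
    have hwi : Traces V ω (w.take i ++ w.drop i) := by rwa [List.take_append_drop]
    have hwj : Traces V ω (w.take j ++ w.drop j) := by rwa [List.take_append_drop]
    have hcut : Traces V ω (w.take i ++ w.drop j) :=
      traces_append.2 ⟨(traces_append.1 hwi).1, hloop ▸ (traces_append.1 hwj).2⟩
    obtain ⟨x, hx, hxw⟩ := ih _ (by simp; omega) hcut rfl
    refine ⟨x, hx, hxw.trans ?_⟩
    rw [mk_append_inv_smul, hloop, ← mk_append_inv_smul, List.take_append_drop]

/-- Schreier's argument: after each letter, return to `ω` along a short path. -/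
theorem Traces.mul_inv_mem_closure {V : Finset Ω} (h : Traces V ω w) {x : FreeGroup X}
    (hx : x.norm ≤ V.card) (hxw : x⁻¹ • ω = (mk w)⁻¹ • ω) :
    mk w * x⁻¹ ∈ Subgroup.closure
      {y | y ∈ MulAction.stabilizer (FreeGroup X) ω ∧ y.norm ≤ 2 * V.card + 1} := by
  induction w using List.reverseRecOn generalizing x with
  | nil =>
    rw [← one_eq_mk, inv_one, one_smul] at hxw
    rw [← one_eq_mk, one_mul]
    exact Subgroup.subset_closure ⟨hxw, by rw [norm_inv_eq]; omega⟩
  | append_singleton w l ih =>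
    have hw := (traces_append.1 h).1
    obtain ⟨y, hy, hyw⟩ := hw.exists_norm_le
    have hloop : y * mk [l] * x⁻¹ ∈ Subgroup.closure
        {y | y ∈ MulAction.stabilizer (FreeGroup X) ω ∧ y.norm ≤ 2 * V.card + 1} := by
      refine Subgroup.subset_closure ⟨?_, ?_⟩
      · rw [MulAction.mem_stabilizer_iff, mul_smul, hxw, mk_append_inv_smul, ← hyw, mul_smul,
          smul_inv_smul, smul_inv_smul]
      · have hl : (mk [l]).norm ≤ 1 := norm_mk_le
        have h₁ := norm_mul_le (y * mk [l]) x⁻¹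
        have h₂ := norm_mul_le y (mk [l])
        rw [norm_inv_eq] at h₁
        omega
    simpa [mul_assoc, ← mul_mk] using mul_mem (ih hw hy hyw) hloop

theorem stabilizer_le_closure_norm_le {V : Finset Ω}
    (hV : ∀ x ∈ MulAction.stabilizer (FreeGroup X) ω, Traces V ω x.toWord) :
    MulAction.stabilizer (FreeGroup X) ω ≤ Subgroup.closure
      {y | y ∈ MulAction.stabilizer (FreeGroup X) ω ∧ y.norm ≤ 2 * V.card + 1} := by
  intro x hx
  have hx1 : (1 : FreeGroup X)⁻¹ • ω = (mk x.toWord)⁻¹ • ω := by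
    rw [mk_toWord, inv_one, one_smul, eq_inv_smul_iff, hx]
  have hmem := (hV x hx).mul_inv_mem_closure (by simp) hx1
  rwa [mk_toWord, inv_one, mul_one] at hmem

theorem traces_toWord_of_mem_gen {L : List (FreeGroup X)} (hω : ω ∈ V)
    (hL : ∀ y ∈ L, y • ω = ω ∧ Traces V ω y.toWord) {x : FreeGroup X} (hx : x ∈ gen L) :
    x • ω = ω ∧ Traces V ω x.toWord := by
  induction hx using Subgroup.closure_induction with
  | mem y hy => exact hL y hy
  | one => exact ⟨one_smul _ _, traces_nil hω⟩
  | mul x y _ _ ihx ihy =>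
    refine ⟨by rw [mul_smul, ihy.1, ihx.1], ?_⟩
    rw [toWord_mul]
    refine Traces.of_red (traces_append.2 ⟨ihx.2, ?_⟩) reduce.red
    rw [mk_toWord, inv_smul_eq_iff.2 ihx.1.symm]
    exact ihy.2
  | inv x _ ih =>
    have hfix : x⁻¹ • ω = ω := inv_smul_eq_iff.2 ih.1.symm
    refine ⟨hfix, ?_⟩
    have := ih.2.invRev
    rwa [mk_toWord, hfix, ← toWord_inv] at this

theorem traces_toWord_of_conj_mem_gen {L : List (FreeGroup X)} {q x : FreeGroup X}
    (hL : ∀ y ∈ L, y • ω = ω ∧ Traces V ω y.toWord) (hq : Traces V ω q.toWord)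
    (hx : q * x * q⁻¹ ∈ gen L) : Traces V (q⁻¹ • ω) x.toWord := by
  obtain ⟨hfix, htr⟩ := traces_toWord_of_mem_gen hq.start_mem hL hx
  have hpath : Traces V (q⁻¹ • ω)
      (FreeGroup.invRev q.toWord ++ ((q * x * q⁻¹).toWord ++ q.toWord)) := by
    have hback := hq.invRev
    have hqinv : mk (FreeGroup.invRev q.toWord) = q⁻¹ := by rw [← inv_mk, mk_toWord]
    rw [mk_toWord] at hback
    refine traces_append.2 ⟨hback, ?_⟩
    rw [hqinv, inv_inv, smul_inv_smul]
    refine traces_append.2 ⟨htr, ?_⟩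
    rwa [mk_toWord, inv_smul_eq_iff.2 hfix.symm]
  have hx' : x.toWord =
      reduce (FreeGroup.invRev q.toWord ++ ((q * x * q⁻¹).toWord ++ q.toWord)) := by
    rw [← toWord_mk, ← mul_mk, ← mul_mk, ← inv_mk, mk_toWord, mk_toWord]
    congr 1
    group
  rw [hx']
  exact hpath.of_red reduce.red

theorem exists_norm_le_pow_smul_eq {V : Finset Ω} {k : ℕ}
    (h : ∀ i < k, Traces V ((mk w ^ i)⁻¹ • ω) w) :
    ∃ x : FreeGroup X, x.norm ≤ V.card ^ k ∧ ∀ i ≤ k, (x ^ i)⁻¹ • ω = (mk w ^ i)⁻¹ • ω := by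
  let ω' : Fin k → Ω := fun i => (mk w ^ (i : ℕ))⁻¹ • ω
  have hω' : Traces (Fintype.piFinset fun _ : Fin k => V : Finset (Fin k → Ω)) ω' w := fun i =>
    Finset.mem_coe.2 (Fintype.mem_piFinset.2 fun j => h j j.2 i)
  obtain ⟨x, hx, hxw⟩ := hω'.exists_norm_le
  refine ⟨x, by simpa using hx, fun i => ?_⟩
  induction i with
  | zero => simp
  | succ i ih =>
    intro hi
    have hstep : x⁻¹ • (mk w ^ i)⁻¹ • ω = (mk w)⁻¹ • (mk w ^ i)⁻¹ • ω := congrFun hxw ⟨i, hi⟩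
    rw [pow_succ, pow_succ, mul_inv_rev, mul_inv_rev, mul_smul, mul_smul, ih (by omega), hstep]

end Tracing

section RootStabilizer

variable {G : Type*} [Group G] {P : Subgroup G} {g x : G} {k : ℕ}

/-- The elements `x` such that left multiplication by `x` does not change the cosets `P g ^ i`,
`i < k`: the common stabilizer of these cosets. -/
def rootStab (P : Subgroup G) (g : G) (k : ℕ) : Subgroup G :=
  ⨅ i : Fin k, P.comap (MulAut.conj (g ^ (i : ℕ))).toMonoidHom

theorem mem_rootStab : x ∈ rootStab P g k ↔ ∀ i < k, g ^ i * x * (g ^ i)⁻¹ ∈ P := by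
  simp only [rootStab, Subgroup.mem_iInf, Fin.forall_iff]
  rfl

/-- The base point of the Schreier graph `G ⧸ P`. -/
abbrev base (P : Subgroup G) : G ⧸ P := (1 : G)

theorem inv_smul_base_eq_iff {a b : G} : a⁻¹ • base P = b⁻¹ • base P ↔ b * a⁻¹ ∈ P := by
  rw [MulAction.Quotient.smul_coe, MulAction.Quotient.smul_coe, eq_comm, QuotientGroup.eq]
  simp

theorem rootStab_eq_stabilizer : rootStab P g k =
    MulAction.stabilizer G fun i : Fin k => (g ^ (i : ℕ))⁻¹ • (base P) := by
  ext x
  rw [mem_rootStab, ← inv_mem_iff (x := x), MulAction.mem_stabilizer_iff, funext_iff,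
    Fin.forall_iff]
  refine forall₂_congr fun i _ => ?_
  rw [Pi.smul_apply, smul_smul, ← mul_inv_rev, eq_comm, inv_smul_base_eq_iff]

/-- The tuples of the cosets `P v ^ i` and `P u ^ i`, `i ≤ k`, agree up to right translation by
an element of `P`. -/
def RootEquiv (P : Subgroup G) (k : ℕ) (v u : G) : Prop :=
  ∃ h ∈ P, ∀ i ≤ k, v ^ i * h * (u ^ i)⁻¹ ∈ P

theorem RootEquiv.trans {u v w : G} (h : RootEquiv P k u v) (h' : RootEquiv P k v w) :
    RootEquiv P k u w := by
  obtain ⟨x, hx, hx'⟩ := h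
  obtain ⟨y, hy, hy'⟩ := h'
  exact ⟨x * y, mul_mem hx hy, fun i hi => by simpa [mul_assoc] using mul_mem (hx' i hi) (hy' i hi)⟩

theorem RootEquiv.pow_mem {v u : G} (h : RootEquiv P k v u) (hv : v ^ k ∈ P) : u ^ k ∈ P := by
  obtain ⟨x, hx, hroot⟩ := h
  simpa [P.mul_mem_cancel_left (mul_mem hv hx)] using hroot k le_rfl

end RootStabilizer

section Core

open FreeGroup

variable {X : Type*} [DecidableEq X] {L : List (FreeGroup X)} {q x : FreeGroup X}

open Classical in
/-- The vertices of the Schreier graph of `gen L` on the paths labelled by the elements of `L`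
and by `q` which start at the base point. -/
noncomputable def core (L : List (FreeGroup X)) (q : FreeGroup X) :
    Finset (FreeGroup X ⧸ gen L) :=
  (((q :: L).flatMap fun y => y.toWord.inits).map fun p =>
    (mk p)⁻¹ • base (gen L)).toFinset

theorem mem_core {ω : FreeGroup X ⧸ gen L} : ω ∈ core L q ↔
    ∃ y ∈ q :: L, ∃ p, p <+: y.toWord ∧ (mk p)⁻¹ • base (gen L) = ω := by
  simp only [core, List.mem_toFinset, List.mem_map, List.mem_flatMap, List.mem_inits]
  grind

/-- The number of prefixes of the words in a list. -/
def totalLength (L : List (FreeGroup X)) : ℕ := (L.map fun y => y.norm + 1).sum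

theorem card_core_le : (core L q).card ≤ totalLength L + q.norm + 1 := by
  classical
  refine (List.toFinset_card_le _).trans ?_
  simp only [totalLength, FreeGroup.norm, List.length_map, List.length_flatMap, List.length_inits,
    List.map_cons, List.sum_cons]
  omega

theorem norm_lt_totalLength {y : FreeGroup X} (hy : y ∈ L) : y.norm < totalLength L :=
  List.single_le_sum (fun _ _ => Nat.zero_le _) _ (List.mem_map_of_mem hy)

theorem traces_core_of_mem {y : FreeGroup X} (hy : y ∈ q :: L) :
    Traces (core L q : Set (FreeGroup X ⧸ gen L)) (base (gen L)) y.toWord :=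
  fun i => mem_core.2 ⟨y, hy, _, List.take_prefix i _, rfl⟩

theorem traces_core_of_conj_mem_gen (hx : q * x * q⁻¹ ∈ gen L) :
    Traces (core L q : Set (FreeGroup X ⧸ gen L)) (q⁻¹ • base (gen L)) x.toWord := by
  refine traces_toWord_of_conj_mem_gen (fun y hy => ⟨?_, ?_⟩)
    (traces_core_of_mem List.mem_cons_self) hx
  · rw [MulAction.Quotient.smul_coe, eq_comm, QuotientGroup.eq]
    simpa using mem_gen_of_mem hy
  · exact traces_core_of_mem (List.mem_cons_of_mem q hy)

theorem norm_pow_le (u : FreeGroup X) (i : ℕ) : (u ^ i).norm ≤ i * u.norm := by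
  induction i with
  | zero => simp
  | succ i ih =>
    rw [pow_succ, Nat.succ_mul]
    exact (FreeGroup.norm_mul_le _ _).trans (Nat.add_le_add_right ih _)

/-- A bound for the lengths of generators of `rootStab (gen L) u k`. -/
def stabBound (L : List (FreeGroup X)) (u : FreeGroup X) (k : ℕ) : ℕ :=
  2 * (totalLength L + k * u.norm + 1) ^ k + 1

theorem rootStab_gen_le_closure (L : List (FreeGroup X)) (u : FreeGroup X) (k : ℕ) :
    rootStab (gen L) u k ≤
      Subgroup.closure {x | x ∈ rootStab (gen L) u k ∧ x.norm ≤ stabBound L u k} := by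
  let V : Finset (Fin k → FreeGroup X ⧸ gen L) :=
    Fintype.piFinset fun i => core L (u ^ (i : ℕ))
  have hcard : V.card ≤ (totalLength L + k * u.norm + 1) ^ k := by
    rw [Fintype.card_piFinset, ← Fin.prod_const]
    refine Finset.prod_le_prod' fun i _ => card_core_le.trans ?_
    have := (norm_pow_le u i).trans (Nat.mul_le_mul_right _ i.2.le)
    omega
  simp only [rootStab_eq_stabilizer]
  refine (stabilizer_le_closure_norm_le (V := V) fun x hx i => ?_).trans
    (Subgroup.closure_mono fun x hx => ⟨hx.1, hx.2.trans ?_⟩)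
  · rw [← rootStab_eq_stabilizer, mem_rootStab] at hx
    exact Finset.mem_coe.2 (Fintype.mem_piFinset.2 fun j =>
      traces_core_of_conj_mem_gen (hx j j.2) i)
  · rw [stabBound]
    omega

theorem exists_conj_toWord_pow_eq (v : FreeGroup X) : ∃ r c : List (X × Bool),
    v = mk r * mk c * (mk r)⁻¹ ∧
      ∀ k ≠ 0, (v ^ k).toWord = r ++ (List.replicate k c).flatten ++ invRev r := by
  refine ⟨reduceCyclically.conjugator v.toWord, reduceCyclically v.toWord, ?_, fun k hk => ?_⟩
  · rw [inv_mk, mul_mk, mul_mk, reduceCyclically.conj_conjugator_reduceCyclically, mk_toWord]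
  · rw [toWord_pow, reduceCyclically.reduce_flatten_replicate isReduced_toWord, if_neg hk]

/-- A bound for the lengths of representatives of the `k`-roots of `gen L`. -/
def repBound (L : List (FreeGroup X)) (k : ℕ) : ℕ :=
  2 * totalLength L + (totalLength L + 1) ^ k

/-- Write `v = r c r⁻¹` with `c` cyclically reduced. The path `r c ^ k r⁻¹` stays in the core, so
that `r` and `c` may be replaced by shorter words without changing the cosets they lead to. -/
theorem exists_rootEquiv_norm_le {v : FreeGroup X} {k : ℕ} (hk : k ≠ 0) (hv : v ^ k ∈ gen L) :
    ∃ w, w.norm ≤ repBound L k ∧ RootEquiv (gen L) k v w := by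
  obtain ⟨r, c, hvrc, hword⟩ := exists_conj_toWord_pow_eq v
  have htrace : Traces (core L 1 : Set (FreeGroup X ⧸ gen L)) (base (gen L)) (v ^ k).toWord := by
    simpa using traces_core_of_conj_mem_gen (L := L) (q := 1) (x := v ^ k) (by simpa using hv)
  rw [hword k hk, List.append_assoc, traces_append, traces_append] at htrace
  obtain ⟨hr, hc, -⟩ := htrace
  obtain ⟨x, hx, hxc⟩ := exists_norm_le_pow_smul_eq hc.of_flatten_replicate
  obtain ⟨y, hy, p, hp, hpr⟩ := mem_core.1 (Finset.mem_coe.1 hr.end_mem)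
  have hplen : p.length ≤ totalLength L := by
    rcases List.mem_cons.1 hy with rfl | hy
    · simp [List.prefix_nil.1 (toWord_one (α := X) ▸ hp)]
    · exact hp.length_le.trans (norm_lt_totalLength hy).le
  have hrp : mk r * (mk p)⁻¹ ∈ gen L := inv_smul_base_eq_iff.1 hpr
  refine ⟨mk p * x * (mk p)⁻¹, ?_, mk r * (mk p)⁻¹, hrp, fun i hi => ?_⟩
  · have hcard : (core L 1).card ^ k ≤ (totalLength L + 1) ^ k :=
      Nat.pow_le_pow_left (card_core_le.trans_eq (by simp)) k
    have h₁ := FreeGroup.norm_mul_le (mk p * x) (mk p)⁻¹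
    have h₂ := FreeGroup.norm_mul_le (mk p) x
    have h₃ := norm_mk_le (L₁ := p)
    rw [norm_inv_eq] at h₁
    rw [repBound]
    omega
  · have hcx : mk r * mk c ^ i * (mk r * x ^ i)⁻¹ ∈ gen L := inv_smul_base_eq_iff.1 (by
      simpa only [mul_inv_rev, mul_smul] using hxc i hi)
    rw [hvrc, conj_pow, conj_pow]
    convert mul_mem hcx hrp using 1
    group

end Core

section RootStabilizerComputable

variable {α G : Type*} [Primcodable α] [Group G] [Primcodable G] [PrimrecGroup G]
  {L : α → List G} {g x : α → G} {k : α → ℕ}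

@[fun_prop]
theorem rePred_mem_rootStab (hL : Primrec L) (hx : Primrec x) (hg : Primrec g) (hk : Primrec k) :
    REPred fun a => x a ∈ rootStab (gen (L a)) (g a) (k a) := by
  simp only [mem_rootStab]
  fun_prop

@[fun_prop]
theorem rePred_notMem_rootStab [SolvableMembership G] (hL : Primrec L) (hx : Primrec x)
    (hg : Primrec g) (hk : Primrec k) :
    REPred fun a => x a ∉ rootStab (gen (L a)) (g a) (k a) := by
  simp only [mem_rootStab, not_forall, exists_prop]
  fun_prop

@[fun_prop]
theorem rePred_rootEquiv (hL : Primrec L) (hx : Primrec x) (hg : Primrec g) (hk : Primrec k) :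
    REPred fun a => RootEquiv (gen (L a)) (k a) (x a) (g a) := by
  simp only [RootEquiv, ← Nat.lt_succ_iff]
  have hmem : REPred fun z : (α × G) × ℕ =>
      x z.1.1 ^ z.2 * z.1.2 * (g z.1.1 ^ z.2)⁻¹ ∈ gen (L z.1.1) :=
    rePred_mem_gen (by fun_prop) (by fun_prop)
  have hforall : REPred fun z : α × G => ∀ i < k z.1 + 1,
      x z.1 ^ i * z.2 * (g z.1 ^ i)⁻¹ ∈ gen (L z.1) :=
    rePred_forall_lt hmem (by fun_prop)
  have hand : REPred fun z : α × G => z.2 ∈ gen (L z.1) ∧ ∀ i < k z.1 + 1,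
      x z.1 ^ i * z.2 * (g z.1 ^ i)⁻¹ ∈ gen (L z.1) :=
    rePred_and (rePred_mem_gen (by fun_prop) (by fun_prop)) hforall
  exact rePred_exists hand

end RootStabilizerComputable

section Ball

variable {α : Type*} [Primcodable α] {n : ℕ}

/-- The elements of norm at most `N` of a free group. -/
def ball (n : ℕ) : ℕ → List (FreeGroup (Fin n))
  | 0 => [1]
  | N + 1 => 1 :: (ball n N).flatMap fun x => (List.finRange n).flatMap fun i =>
      [FreeGroup.of i * x, (FreeGroup.of i)⁻¹ * x]

theorem mem_ball_of_norm_le {N : ℕ} {x : FreeGroup (Fin n)} (hx : x.norm ≤ N) : x ∈ ball n N := by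
  induction N generalizing x with
  | zero => simpa [ball] using hx
  | succ N ih =>
    rw [ball, List.mem_cons, List.mem_flatMap]
    rcases hw : x.toWord with _ | ⟨⟨i, b⟩, w⟩
    · exact .inl (FreeGroup.toWord_eq_nil_iff.1 hw)
    · have hxw : x = FreeGroup.mk [(i, b)] * FreeGroup.mk w := by
        rw [FreeGroup.mul_mk, List.singleton_append, ← hw, FreeGroup.mk_toWord]
      have hnorm : (FreeGroup.mk w).norm ≤ N := by
        rw [FreeGroup.norm, hw, List.length_cons] at hx
        exact FreeGroup.norm_mk_le.trans (Nat.le_of_succ_le_succ hx)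
      refine .inr ⟨_, ih hnorm, List.mem_flatMap.2 ⟨i, List.mem_finRange i, ?_⟩⟩
      rw [List.mem_pair, hxw]
      cases b
      exacts [.inr rfl, .inl rfl]

@[fun_prop]
theorem primrec_ball {N : α → ℕ} (hN : Primrec N) : Primrec fun a => ball n (N a) := by
  have hstep : Primrec₂ fun (_ : ℕ) (l : List (FreeGroup (Fin n))) => 1 :: l.flatMap fun y =>
      (List.finRange n).flatMap fun i => [FreeGroup.of i * y, (FreeGroup.of i)⁻¹ * y] := by
    refine Primrec₂.mk ?_
    have : Primrec fun i : Fin n => FreeGroup.of i := by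
      unfold FreeGroup.of
      fun_prop
    fun_prop
  refine Primrec.comp (f := ball n) ((Primrec.nat_rec₁ [1] hstep).of_eq fun N => ?_) hN
  induction N with
  | zero => rfl
  | succ N ih => rw [ball, ← ih]

@[fun_prop]
theorem primrec_norm {x : α → FreeGroup (Fin n)} (hx : Primrec x) :
    Primrec fun a => (x a).norm := by
  unfold FreeGroup.norm
  fun_prop

@[fun_prop]
theorem primrec_totalLength {L : α → List (FreeGroup (Fin n))} (hL : Primrec L) :
    Primrec fun a => totalLength (L a) := by
  unfold totalLength List.sum
  exact primrec_foldr (h := fun _ x y => x + y) (by fun_prop) (by fun_prop) (by fun_prop)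

@[fun_prop]
theorem primrec_stabBound {L : α → List (FreeGroup (Fin n))} {u : α → FreeGroup (Fin n)}
    {k : α → ℕ} (hL : Primrec L) (hu : Primrec u) (hk : Primrec k) :
    Primrec fun a => stabBound (L a) (u a) (k a) := by
  unfold stabBound
  fun_prop

@[fun_prop]
theorem primrec_repBound {L : α → List (FreeGroup (Fin n))} {k : α → ℕ} (hL : Primrec L)
    (hk : Primrec k) : Primrec fun a => repBound (L a) (k a) := by
  unfold repBound
  fun_prop

theorem rootStab_le_gen_iff {L W : List (FreeGroup (Fin n))} {u : FreeGroup (Fin n)} {k : ℕ} :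
    rootStab (gen L) u k ≤ gen W ↔
      ∀ x ∈ ball n (stabBound L u k), x ∉ rootStab (gen L) u k ∨ x ∈ gen W := by
  refine ⟨fun h x _ => or_iff_not_imp_left.2 fun hx => h (not_not.1 hx), fun h => ?_⟩
  refine (rootStab_gen_le_closure L u k).trans ((Subgroup.closure_le _).2 fun x hx => ?_)
  exact (h x (mem_ball_of_norm_le hx.2)).resolve_left (not_not.2 hx.1)

@[fun_prop]
theorem rePred_rootStab_le_gen {L W : α → List (FreeGroup (Fin n))} {u : α → FreeGroup (Fin n)}
    {k : α → ℕ} (hL : Primrec L) (hu : Primrec u) (hk : Primrec k) (hW : Primrec W) :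
    REPred fun a => rootStab (gen (L a)) (u a) (k a) ≤ gen (W a) := by
  simp only [rootStab_le_gen_iff]
  have hor : REPred fun z : α × FreeGroup (Fin n) =>
      z.2 ∉ rootStab (gen (L z.1)) (u z.1) (k z.1) ∨ z.2 ∈ gen (W z.1) :=
    rePred_or (rePred_notMem_rootStab (by fun_prop) (by fun_prop) (by fun_prop) (by fun_prop))
      (rePred_mem_gen (by fun_prop) (by fun_prop))
  exact rePred_ball hor (by fun_prop)

theorem fg_rootStab_gen (L : List (FreeGroup (Fin n))) (u : FreeGroup (Fin n)) (k : ℕ) :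
    (rootStab (gen L) u k).FG := by
  classical
  let W := (ball n (stabBound L u k)).filter fun x => x ∈ rootStab (gen L) u k
  have hW : gen W = rootStab (gen L) u k :=
    le_antisymm (gen_le_iff.2 fun x hx => by simpa using (List.mem_filter.1 hx).2)
      (rootStab_le_gen_iff.2 fun x hx => or_iff_not_imp_left.2 fun hxs =>
        mem_gen_of_mem (List.mem_filter.2 ⟨hx, by simpa using hxs⟩))
  exact hW ▸ fg_gen W

end Ball

section Powers

variable {G B : Type*} [Group G] [CommGroup B] {P S : Subgroup G} {g x : G} {k : ℕ}

theorem mul_pow_mul_inv_mem (hx : x ∈ rootStab P g k) {i : ℕ} (hi : i ≤ k) :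
    (x * g) ^ i * (g ^ i)⁻¹ ∈ P := by
  rw [mem_rootStab] at hx
  induction i with
  | zero => simp
  | succ i ih =>
    convert mul_mem (ih (Nat.le_of_succ_le hi)) (hx i hi) using 1
    rw [pow_succ, pow_succ]
    group

theorem rootStab_anti {j : ℕ} (hjk : j ≤ k) : rootStab P g k ≤ rootStab P g j := fun _ hx =>
  mem_rootStab.2 fun i hi => mem_rootStab.1 hx i (hi.trans_le hjk)

/- The homomorphism is the product of the `k` homomorphisms `x ↦ q (g ^ i * x * g ^ (-i))`. -/
theorem exists_monoidHom_mul_pow (q : S →* B) (g : G) (k : ℕ) :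
    ∃ δ : rootStab S g k →* B,
      ∀ x, δ x = q ⟨(x * g) ^ k * (g ^ k)⁻¹, mul_pow_mul_inv_mem x.2 le_rfl⟩ := by
  induction k with
  | zero =>
    refine ⟨1, fun x => ((congrArg q (Subtype.ext ?_)).trans (map_one q)).symm⟩
    simp
  | succ k ih =>
    obtain ⟨δ, hδ⟩ := ih
    let conj : rootStab S g (k + 1) →* S :=
      ((MulAut.conj (g ^ k)).toMonoidHom.comp (Subgroup.subtype _)).codRestrict S
        fun x => mem_rootStab.1 x.2 k (Nat.lt_succ_self k)
    refine ⟨δ.comp (Subgroup.inclusion (rootStab_anti (Nat.le_succ k))) * q.comp conj,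
      fun x => ?_⟩
    rw [MonoidHom.mul_apply, MonoidHom.comp_apply, hδ, MonoidHom.comp_apply, ← map_mul]
    congr 1
    refine Subtype.ext ?_
    change (x * g) ^ k * (g ^ k)⁻¹ * (g ^ k * x * (g ^ k)⁻¹) =
      (x * g) ^ (k + 1) * (g ^ (k + 1))⁻¹
    rw [pow_succ, pow_succ]
    group

end Powers

section Saturation

open scoped commutatorElement

universe u v

variable {G : Type u} {A : Type v} [Group G] [CommGroup A]
  {H : Subgroup (G × A)} {g x : G × A} {j k : ℕ}

/-- The subgroup `H A` of `G × A`. -/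
def saturation (H : Subgroup (G × A)) : Subgroup (G × A) :=
  (H.map (MonoidHom.fst _ _)).comap (MonoidHom.fst _ _)

theorem le_saturation : H ≤ saturation H := Subgroup.le_comap_map _ _

/- Changing the second components of `x` and `y` does not change their commutator. -/
theorem commutatorElement_mem_of_mem_saturation {y : G × A} (hx : x ∈ saturation H)
    (hy : y ∈ saturation H) : ⁅x, y⁆ ∈ H := by
  obtain ⟨h, hh, hhx⟩ := hx
  obtain ⟨h', hh', hhy⟩ := hy
  have heq : ⁅x, y⁆ = ⁅h, h'⁆ := by
    refine Prod.ext ?_ ?_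
    · simp only [commutatorElement_def, Prod.fst_mul, Prod.fst_inv]
      rw [show x.1 = h.1 from hhx.symm, show y.1 = h'.1 from hhy.symm]
    · simp [commutatorElement_def]
  rw [heq, commutatorElement_def]
  exact mul_mem (mul_mem (mul_mem hh hh') (inv_mem hh)) (inv_mem hh')

theorem exists_monoidHom_saturation_ker_eq (H : Subgroup (G × A)) :
    ∃ (B : Type (max u v)) (_ : CommGroup B) (q : saturation H →* B), ∀ x, q x = 1 ↔ ↑x ∈ H := by
  let N := H.subgroupOf (saturation H)
  have hker : (Abelianization.of (G := saturation H)).ker ≤ N := by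
    rw [Abelianization.ker_of, commutator_def, Subgroup.commutator_le]
    exact fun x _ y _ => commutatorElement_mem_of_mem_saturation x.2 y.2
  refine ⟨_, inferInstance, (QuotientGroup.mk' (N.map Abelianization.of)).comp Abelianization.of,
    fun x => ?_⟩
  rw [MonoidHom.comp_apply, QuotientGroup.mk'_apply, QuotientGroup.eq_one_iff,
    ← Subgroup.mem_comap, Subgroup.comap_map_eq, sup_eq_left.2 hker, Subgroup.mem_subgroupOf]

theorem exists_monoidHom_rootStab_saturation (H : Subgroup (G × A)) (g : G × A) (k : ℕ) :
    ∃ (B : Type (max u v)) (_ : CommGroup B) (δ : rootStab (saturation H) g k →* B),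
      ∀ x, δ x = 1 ↔ (x * g) ^ k * (g ^ k)⁻¹ ∈ H := by
  obtain ⟨B, _, q, hq⟩ := exists_monoidHom_saturation_ker_eq H
  obtain ⟨δ, hδ⟩ := exists_monoidHom_mul_pow q g k
  exact ⟨B, _, δ, fun x => by rw [hδ, hq]⟩

/-- The elements `x` for which the conjugates `g ^ i * x * g ^ (-i)`, `i < k`, lie in `H A` and
`(x * g) ^ k` lies in the coset `H * g ^ k`. -/
def powGroup (H : Subgroup (G × A)) (g : G × A) (k : ℕ) : Subgroup (G × A) where
  carrier := {x | x ∈ rootStab (saturation H) g k ∧ (x * g) ^ k * (g ^ k)⁻¹ ∈ H}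
  one_mem' := ⟨one_mem _, by simp⟩
  mul_mem' := by
    rintro x y ⟨hx, hxH⟩ ⟨hy, hyH⟩
    obtain ⟨B, _, δ, hδ⟩ := exists_monoidHom_rootStab_saturation H g k
    refine ⟨mul_mem hx hy, (hδ (⟨x, hx⟩ * ⟨y, hy⟩)).1 ?_⟩
    rw [map_mul, (hδ ⟨x, hx⟩).2 hxH, (hδ ⟨y, hy⟩).2 hyH, mul_one]
  inv_mem' := by
    rintro x ⟨hx, hxH⟩
    obtain ⟨B, _, δ, hδ⟩ := exists_monoidHom_rootStab_saturation H g k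
    refine ⟨inv_mem hx, (hδ (⟨x, hx⟩⁻¹)).1 ?_⟩
    rw [map_inv, (hδ ⟨x, hx⟩).2 hxH, inv_one]

theorem mem_powGroup : x ∈ powGroup H g k ↔
    x ∈ rootStab (saturation H) g k ∧ (x * g) ^ k * (g ^ k)⁻¹ ∈ H :=
  Iff.rfl

/-- The image in `G` of the elements of `G × A` whose `A`-component, raised to the power `k`,
gives an element of `H`. A power `g ^ k` can only lie in `H` if `g.1 ^ k` lies in this subgroup. -/
def rootBase (H : Subgroup (G × A)) (k : ℕ) : Subgroup G :=
  (H.comap (scaleHom k)).map (MonoidHom.fst _ _)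

theorem mem_rootBase {u : G} : u ∈ rootBase H k ↔ ∃ a : A, (u, a ^ k) ∈ H := by
  simp [rootBase, Subgroup.mem_map, scaleHom_apply]

theorem rootBase_le : rootBase H k ≤ H.map (MonoidHom.fst _ _) := by
  intro u hu
  obtain ⟨a, ha⟩ := mem_rootBase.1 hu
  exact ⟨_, ha, rfl⟩

theorem pow_fst_mem_rootBase (hg : g ^ k ∈ H) : g.1 ^ k ∈ rootBase H k :=
  mem_rootBase.2 ⟨g.2, hg⟩

theorem comap_fst_rootStab_le :
    (rootStab (rootBase H k) g.1 k).comap (MonoidHom.fst _ _) ≤ rootStab (saturation H) g k :=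
  fun _ hx => mem_rootStab.2 fun i hi => rootBase_le (mem_rootStab.1 hx i hi)

/-- The subgroup `K` for which `K * g` consists of the `y` with `y.1 ∈ rootStab P g.1 k * g.1`
and `y ^ k ∈ H * g ^ k`, where `P = rootBase H k`. -/
def rootGroup (H : Subgroup (G × A)) (g : G × A) (k : ℕ) : Subgroup (G × A) :=
  (rootStab (rootBase H k) g.1 k).comap (MonoidHom.fst _ _) ⊓ powGroup H g k

theorem mem_rootGroup : x ∈ rootGroup H g k ↔
    x.1 ∈ rootStab (rootBase H k) g.1 k ∧ (x * g) ^ k * (g ^ k)⁻¹ ∈ H :=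
  ⟨fun h => ⟨h.1, h.2.2⟩, fun h => ⟨h.1, comap_fst_rootStab_le h.1, h.2⟩⟩

theorem map_fst_rootGroup :
    (rootGroup H g k).map (MonoidHom.fst _ _) = rootStab (rootBase H k) g.1 k := by
  refine le_antisymm (Subgroup.map_le_iff_le_comap.2 inf_le_left) fun u hu => ?_
  obtain ⟨a, ha⟩ := mem_rootBase.1 (mul_pow_mul_inv_mem hu le_rfl)
  refine ⟨(u, a), mem_rootGroup.2 ⟨hu, ?_⟩, rfl⟩
  convert ha using 1
  ext <;> simp [mul_pow]

theorem comap_inr_rootGroup : (rootGroup H g k).comap (MonoidHom.inr _ _) =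
    (H.comap (scaleHom k)).comap (MonoidHom.inr _ _) := by
  ext a
  have hpow : ((1, a) * g) ^ k * (g ^ k)⁻¹ = scaleHom k (1, a) := by
    ext <;> simp [mul_pow, scaleHom_apply]
  simp only [Subgroup.mem_comap, mem_rootGroup, MonoidHom.inr_apply, hpow, one_mem, true_and]

end Saturation

section Extension

variable {G A : Type*} [Group G] [Group A] {K : Subgroup (G × A)}

theorem gen_map_fst (W : List (G × A)) :
    gen (W.map Prod.fst) = (gen W).map (MonoidHom.fst _ _) := by
  rw [← gen_map]
  rfl

theorem gen_eq_iff_map_fst_le_and_comap_inr_le {W : List (G × A)} :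
    gen W = K ↔ (∀ w ∈ W, w ∈ K) ∧ K.map (MonoidHom.fst _ _) ≤ gen (W.map Prod.fst) ∧
      K.comap (MonoidHom.inr _ _) ≤ (gen W).comap (MonoidHom.inr _ _) := by
  rw [gen_map_fst]
  constructor
  · rintro rfl
    exact ⟨fun w => mem_gen_of_mem, le_rfl, le_rfl⟩
  · rintro ⟨hW, hfst, hinr⟩
    refine le_antisymm (gen_le_iff.2 hW) fun x hx => ?_
    obtain ⟨y, hy, hyx⟩ := hfst ⟨x, hx, rfl⟩
    have hxy : y⁻¹ * x = MonoidHom.inr G A (y⁻¹ * x).2 := by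
      refine Prod.ext ?_ rfl
      simp [show y.1 = x.1 from hyx]
    have hmem : y⁻¹ * x ∈ gen W := by
      rw [hxy]
      refine hinr ?_
      rw [Subgroup.mem_comap, ← hxy]
      exact mul_mem (inv_mem (gen_le_iff.2 hW hy)) hx
    simpa using mul_mem hy hmem

theorem fg_of_fg_map_fst_of_fg_comap_inr (hfst : (K.map (MonoidHom.fst _ _)).FG)
    (hinr : (K.comap (MonoidHom.inr _ _)).FG) : K.FG := by
  obtain ⟨U, hU⟩ := exists_gen_eq hfst
  obtain ⟨Z, hZ⟩ := exists_gen_eq hinr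
  have hlift : ∀ u : {u // u ∈ U}, ∃ x ∈ K, x.1 = u := fun u => by
    obtain ⟨x, hx, hxu⟩ := hU.le (mem_gen_of_mem u.2)
    exact ⟨x, hx, hxu⟩
  choose lift hlift_mem hlift_fst using hlift
  let W := U.attach.map lift ++ Z.map (MonoidHom.inr G A)
  have hW : gen W = K := by
    rw [gen_eq_iff_map_fst_le_and_comap_inr_le]
    refine ⟨fun w hw => ?_, ?_, ?_⟩
    · rcases List.mem_append.1 hw with hw | hw
      · obtain ⟨u, -, rfl⟩ := List.mem_map.1 hw
        exact hlift_mem u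
      · obtain ⟨z, hz, rfl⟩ := List.mem_map.1 hw
        exact hZ.le (mem_gen_of_mem hz)
    · rw [← hU]
      refine gen_le_iff.2 fun u hu => mem_gen_of_mem ?_
      refine List.mem_map.2 ⟨lift ⟨u, hu⟩, ?_, hlift_fst _⟩
      exact (List.mem_append_left _ (List.mem_map_of_mem (List.mem_attach _ _)))
    · rw [← hZ]
      exact gen_le_iff.2 fun z hz =>
        mem_gen_of_mem (List.mem_append_right _ (List.mem_map_of_mem hz))
  exact hW ▸ fg_gen W

end Extension

section RootGroupComputable

variable {n : ℕ}

theorem gen_map_fst_eq_rootBase {G A : Type*} [Group G] [CommGroup A] {Q : List (G × A)}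
    {H : Subgroup (G × A)} {k : ℕ} (hQ : gen Q = H.comap (scaleHom k)) :
    gen (Q.map Prod.fst) = rootBase H k := by
  rw [gen_map_fst, hQ, rootBase]

theorem fg_rootGroup_gen {A : Type*} [CommGroup A] [IsMulTorsionFree A] [Group.FG A]
    (L : List (FreeGroup (Fin n) × A)) (g : FreeGroup (Fin n) × A) {k : ℕ} (hk : 0 < k) :
    (rootGroup (gen L) g k).FG := by
  obtain ⟨Q, hQ⟩ := exists_gen_eq (fg_comap_scaleHom L hk)
  refine fg_of_fg_map_fst_of_fg_comap_inr ?_ ?_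
  · rw [map_fst_rootGroup, ← gen_map_fst_eq_rootBase hQ]
    exact fg_rootStab_gen _ _ _
  · rw [comap_inr_rootGroup, ← hQ]
    exact fg_comap_inr_gen Q

variable {α : Type*} [Primcodable α] {m : ℕ}

@[fun_prop]
theorem rePred_gen_eq_rootGroup {W L : α → List (FTA n m)} {g : α → FTA n m} {k : α → ℕ}
    (hk₀ : ∀ a, 0 < k a) (hW : Primrec W) (hL : Primrec L) (hg : Primrec g) (hk : Primrec k) :
    REPred fun a => gen (W a) = rootGroup (gen (L a)) (g a) (k a) := by
  have hre : REPred fun a => ∃ y : List (FTA n m) × List (Multiplicative (Fin m → ℤ)),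
      gen y.1 = (gen (L a)).comap (scaleHom (k a)) ∧
      gen y.2 = (gen y.1).comap (MonoidHom.inr _ _) ∧
      (∀ w ∈ W a, w.1 ∈ rootStab (gen (y.1.map Prod.fst)) (g a).1 (k a) ∧
        (w * g a) ^ k a * (g a ^ k a)⁻¹ ∈ gen (L a)) ∧
      rootStab (gen (y.1.map Prod.fst)) (g a).1 (k a) ≤ gen ((W a).map Prod.fst) ∧
      ∀ z ∈ y.2, (1, z) ∈ gen (W a) := by
    refine rePred_exists ?_
    refine rePred_and (rePred_gen_eq_comap_scaleHom (fun y => hk₀ y.1) (by fun_prop) (by fun_prop)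
      (by fun_prop)) ?_
    refine rePred_and (rePred_gen_eq_comap_inr (by fun_prop) (by fun_prop)) ?_
    refine rePred_and ?_ ?_
    · refine rePred_ball ?_ (by fun_prop)
      exact rePred_and (rePred_mem_rootStab (by fun_prop) (by fun_prop) (by fun_prop) (by fun_prop))
        (rePred_mem_gen (by fun_prop) (by fun_prop))
    · exact rePred_and (rePred_rootStab_le_gen (by fun_prop) (by fun_prop) (by fun_prop)
        (by fun_prop)) (rePred_ball (rePred_mem_gen (by fun_prop) (by fun_prop)) (by fun_prop))
  refine hre.of_eq fun a => ?_
  rw [gen_eq_iff_map_fst_le_and_comap_inr_le, map_fst_rootGroup, comap_inr_rootGroup]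
  simp only [mem_rootGroup]
  constructor
  · rintro ⟨⟨Q, Z⟩, hQ, hZ, hmem, hfst, hinr⟩
    rw [← gen_map_fst_eq_rootBase hQ, ← hQ, ← hZ, gen_le_iff]
    exact ⟨hmem, hfst, hinr⟩
  · rintro ⟨hmem, hfst, hinr⟩
    obtain ⟨Q, hQ⟩ := exists_gen_eq (fg_comap_scaleHom (L a) (hk₀ a))
    obtain ⟨Z, hZ⟩ := exists_gen_eq (fg_comap_inr_gen Q)
    rw [← gen_map_fst_eq_rootBase hQ] at hmem hfst
    rw [← hQ, ← hZ, gen_le_iff] at hinr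
    exact ⟨(Q, Z), hQ, hZ, hmem, hfst, hinr⟩

end RootGroupComputable

section CosetDecomposition

variable {G : Type*} [Group G]

/-- The analogue of `IsCosetDecomposition` in an arbitrary group, for cosets given by elements of
the group instead of codes. -/
structure IsDecomposition (H : Subgroup G) (X : Set G) (D : List (List G × G)) : Prop where
  rep_mem : ∀ c ∈ D, c.2 ∈ X
  disjoint : D.Pairwise fun c c' =>
    Disjoint (rightCoset (gen c.1) c.2) (rightCoset (gen c'.1) c'.2)
  eq : X = conjBy {g | ∃ c ∈ D, g ∈ rightCoset (gen c.1) c.2} H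

theorem mem_rightCoset_iff {K : Subgroup G} {g y : G} : y ∈ rightCoset K g ↔ y * g⁻¹ ∈ K :=
  ⟨by rintro ⟨x, hx, rfl⟩; simpa using hx, fun h => ⟨_, h, by simp⟩⟩

theorem conj_pow_mem_iff {H : Subgroup G} {h x : G} (hh : h ∈ H) (k : ℕ) :
    (h⁻¹ * x * h) ^ k ∈ H ↔ x ^ k ∈ H := by
  have hconj : (h⁻¹ * x * h) ^ k = h⁻¹ * x ^ k * h := by
    simpa using conj_pow (i := k) (a := h⁻¹) (b := x)
  rw [hconj, H.mul_mem_cancel_right hh, H.mul_mem_cancel_left (inv_mem hh)]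

end CosetDecomposition

section RootSystem

variable {G A : Type*} [Group G] [CommGroup A] {H : Subgroup (G × A)} {k : ℕ}
  {D : List (List (G × A) × (G × A))}

/-- A list of elements representing, up to `RootEquiv`, all `k`-roots of `P`. Two of them give
different tuples of cosets of `P`, which is weaker than not being related by `RootEquiv`, but
involves only finitely many elements. -/
structure IsRootTransversal (P : Subgroup G) (k : ℕ) (R : List G) : Prop where
  separated : R.Pairwise fun w w' => ∃ i < k + 1, w ^ i * (w' ^ i)⁻¹ ∉ P
  exists_rootEquiv : ∀ v, v ^ k ∈ P → ∃ w ∈ R, RootEquiv P k v w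

/-- A list of `k`-roots `g` of `H` whose free parts form a transversal, each accompanied by
generators of `rootGroup H g k`. -/
structure IsRootSystem (H : Subgroup (G × A)) (k : ℕ) (D : List (List (G × A) × (G × A))) :
    Prop where
  pow_mem : ∀ c ∈ D, c.2 ^ k ∈ H
  gen_eq : ∀ c ∈ D, gen c.1 = rootGroup H c.2 k
  isRootTransversal : IsRootTransversal (rootBase H k) k (D.map fun c => c.2.1)

theorem mem_rightCoset_rootGroup_iff {g y : G × A} (hg : g ^ k ∈ H) :
    y ∈ rightCoset (rootGroup H g k) g ↔
      y.1 * g.1⁻¹ ∈ rootStab (rootBase H k) g.1 k ∧ y ^ k ∈ H := by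
  rw [mem_rightCoset_iff, mem_rootGroup, inv_mul_cancel_right, H.mul_mem_cancel_right (inv_mem hg)]
  rfl

theorem pow_mul_pow_inv_mem_rootBase {g g' y : G × A}
    (hy : y.1 * g.1⁻¹ ∈ rootStab (rootBase H k) g.1 k)
    (hy' : y.1 * g'.1⁻¹ ∈ rootStab (rootBase H k) g'.1 k) {i : ℕ} (hi : i ≤ k) :
    g.1 ^ i * (g'.1 ^ i)⁻¹ ∈ rootBase H k := by
  have h := mul_pow_mul_inv_mem hy hi
  have h' := mul_pow_mul_inv_mem hy' hi
  rw [inv_mul_cancel_right] at h h'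
  simpa [mul_assoc] using mul_mem (inv_mem h) h'

theorem inv_mul_mul_mul_inv_mem_rootStab {P : Subgroup G} {h u v : G}
    (hroot : ∀ i ≤ k, v ^ i * h * (u ^ i)⁻¹ ∈ P) : h⁻¹ * v * h * u⁻¹ ∈ rootStab P u k := by
  refine mem_rootStab.2 fun i hi => ?_
  convert mul_mem (inv_mem (hroot i hi.le)) (hroot (i + 1) hi) using 1
  rw [pow_succ, pow_succ']
  group

theorem IsRootSystem.exists_conj_mem_rightCoset (hD : IsRootSystem H k D) {y : G × A}
    (hy : y ^ k ∈ H) : ∃ h ∈ H, ∃ c ∈ D, h⁻¹ * y * h ∈ rightCoset (gen c.1) c.2 := by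
  obtain ⟨_, hw, h, hh, hroot⟩ :=
    hD.isRootTransversal.exists_rootEquiv y.1 (pow_fst_mem_rootBase hy)
  obtain ⟨c, hc, rfl⟩ := List.mem_map.1 hw
  obtain ⟨h, hhH, rfl⟩ := rootBase_le hh
  refine ⟨h, hhH, c, hc, ?_⟩
  rw [hD.gen_eq c hc, mem_rightCoset_rootGroup_iff (hD.pow_mem c hc), conj_pow_mem_iff hhH]
  exact ⟨inv_mul_mul_mul_inv_mem_rootStab hroot, hy⟩

theorem IsRootSystem.isDecomposition (hD : IsRootSystem H k D) :
    IsDecomposition H (kRoots k H) D where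
  rep_mem := hD.pow_mem
  disjoint := by
    have hsep := List.pairwise_map.1 hD.isRootTransversal.separated
    refine hsep.imp_of_mem fun {c c'} hc hc' ⟨i, hi, hcc'⟩ => ?_
    rw [hD.gen_eq c hc, hD.gen_eq c' hc', Set.disjoint_left]
    intro y hy hy'
    rw [mem_rightCoset_rootGroup_iff (hD.pow_mem _ ‹_›)] at hy hy'
    exact hcc' (pow_mul_pow_inv_mem_rootBase hy.1 hy'.1 (Nat.le_of_lt_succ hi))
  eq := by
    ext y
    constructor
    · intro hy
      obtain ⟨h, hh, c, hc, hmem⟩ := hD.exists_conj_mem_rightCoset hy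
      exact ⟨h⁻¹, inv_mem hh, _, ⟨c, hc, hmem⟩, by group⟩
    · rintro ⟨h, hh, x, ⟨c, hc, hx⟩, rfl⟩
      rw [hD.gen_eq c hc, mem_rightCoset_rootGroup_iff (hD.pow_mem c hc)] at hx
      exact (conj_pow_mem_iff hh k).2 hx.2

theorem IsRootSystem.pairwise_fst_ne (hD : IsRootSystem H k D) :
    D.Pairwise fun c c' => c.2.1 ≠ c'.2.1 := by
  have hsep := List.pairwise_map.1 hD.isRootTransversal.separated
  refine hsep.imp fun {c c'} ⟨i, _, hcc'⟩ heq => hcc' ?_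
  rw [heq, mul_inv_cancel]
  exact one_mem _

end RootSystem

section Existence

variable {n : ℕ} {A : Type*} [CommGroup A] {k : ℕ}

theorem exists_isRootTransversal (L : List (FreeGroup (Fin n))) (hk : k ≠ 0) :
    ∃ R, (∀ w ∈ R, w ^ k ∈ gen L) ∧ IsRootTransversal (gen L) k R := by
  classical
  let B := (ball n (repBound L k)).filter fun w => w ^ k ∈ gen L
  let R := B.pwFilter fun w w' => ¬ RootEquiv (gen L) k w w'
  refine ⟨R, fun w hw => ?_, ?_, fun v hv => ?_⟩
  · simpa using (List.mem_filter.1 (List.pwFilter_subset _ hw)).2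
  · refine (List.pairwise_pwFilter _).imp fun {w w'} hww' => ?_
    by_contra! h
    exact hww' ⟨1, one_mem _, fun i hi => by simpa using h i (Nat.lt_succ_of_le hi)⟩
  · by_contra! hR
    have hB : ∀ w ∈ B, ¬ RootEquiv (gen L) k v w :=
      (List.forall_mem_pwFilter (fun {x y z} hxz => by
        by_contra! h
        exact hxz (h.1.trans h.2)) v B).1 hR
    obtain ⟨w, hw, hvw⟩ := exists_rootEquiv_norm_le hk hv
    refine hB w (List.mem_filter.2 ⟨mem_ball_of_norm_le hw, ?_⟩) hvw
    exact decide_eq_true (hvw.pow_mem hv)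

theorem exists_isRootSystem [IsMulTorsionFree A] [Group.FG A] (L : List (FreeGroup (Fin n) × A))
    (hk : 0 < k) : ∃ D, IsRootSystem (gen L) k D := by
  obtain ⟨Q, hQ⟩ := exists_gen_eq (fg_comap_scaleHom L hk)
  obtain ⟨R, hR_pow, hR⟩ := exists_isRootTransversal (Q.map Prod.fst) hk.ne'
  rw [gen_map_fst_eq_rootBase hQ] at hR_pow hR
  have hlift : ∀ w ∈ R, ∃ c : List (FreeGroup (Fin n) × A) × (FreeGroup (Fin n) × A),
      c.2.1 = w ∧ c.2 ^ k ∈ gen L ∧ gen c.1 = rootGroup (gen L) c.2 k := fun w hw => by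
    obtain ⟨a, ha⟩ := mem_rootBase.1 (hR_pow w hw)
    obtain ⟨W, hW⟩ := exists_gen_eq (fg_rootGroup_gen L (w, a) hk)
    exact ⟨(W, w, a), rfl, ha, hW⟩
  choose! c hc_fst hc_pow hc_gen using hlift
  have hmap : (R.map c).map (fun c => c.2.1) = R := by
    rw [List.map_map]
    exact (List.map_congr_left hc_fst).trans (List.map_id R)
  exact ⟨R.map c, by simpa using hc_pow, by simpa using hc_gen, hmap.symm ▸ hR⟩

theorem isRootTransversal_gen_iff {L R : List (FreeGroup (Fin n))} (hk : k ≠ 0) :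
    IsRootTransversal (gen L) k R ↔
      R.Pairwise (fun w w' => ∃ i < k + 1, w ^ i * (w' ^ i)⁻¹ ∉ gen L) ∧
      ∀ v ∈ ball n (repBound L k), v ^ k ∉ gen L ∨ ∃ w ∈ R, RootEquiv (gen L) k v w := by
  refine ⟨fun h => ⟨h.1, fun v _ => or_iff_not_imp_left.2 fun hv => h.2 v (not_not.1 hv)⟩,
    fun h => ⟨h.1, fun v hv => ?_⟩⟩
  obtain ⟨u, hu, hvu⟩ := exists_rootEquiv_norm_le hk hv
  obtain ⟨w, hw, huw⟩ :=
    (h.2 u (mem_ball_of_norm_le hu)).resolve_left (not_not.2 (hvu.pow_mem hv))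
  exact ⟨w, hw, hvu.trans huw⟩

end Existence

section RootSystemComputable

variable {α : Type*} [Primcodable α] {n m : ℕ}

@[fun_prop]
theorem rePred_isRootTransversal {L R : α → List (FreeGroup (Fin n))} {k : α → ℕ}
    (hk₀ : ∀ a, 0 < k a) (hL : Primrec L) (hk : Primrec k) (hR : Primrec R) :
    REPred fun a => IsRootTransversal (gen (L a)) (k a) (R a) := by
  simp only [isRootTransversal_gen_iff (hk₀ _).ne']
  refine rePred_and (rePred_pairwise ?_ hR) ?_
  · exact rePred_exists_lt (rePred_notMem_gen (by fun_prop) (by fun_prop)) (by fun_prop)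
  · refine rePred_ball ?_ (by fun_prop)
    refine rePred_or (rePred_notMem_gen (by fun_prop) (by fun_prop)) ?_
    refine rePred_bex ?_ (by fun_prop)
    exact rePred_rootEquiv (by fun_prop) (by fun_prop) (by fun_prop) (by fun_prop)

@[fun_prop]
theorem rePred_isRootSystem {L : α → List (FTA n m)} {k : α → ℕ}
    {D : α → List (List (FTA n m) × FTA n m)} (hk₀ : ∀ a, 0 < k a) (hL : Primrec L)
    (hk : Primrec k) (hD : Primrec D) : REPred fun a => IsRootSystem (gen (L a)) (k a) (D a) := by
  have hre : REPred fun a => (∀ c ∈ D a, c.2 ^ k a ∈ gen (L a)) ∧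
      (∀ c ∈ D a, gen c.1 = rootGroup (gen (L a)) c.2 (k a)) ∧
      ∃ Q : List (FTA n m), gen Q = (gen (L a)).comap (scaleHom (k a)) ∧
        IsRootTransversal (gen (Q.map Prod.fst)) (k a) ((D a).map fun c => c.2.1) := by
    refine rePred_and (rePred_ball ?_ hD) (rePred_and (rePred_ball ?_ hD) (rePred_exists ?_))
    · exact rePred_mem_gen (by fun_prop) (by fun_prop)
    · exact rePred_gen_eq_rootGroup (fun y => hk₀ y.1) (by fun_prop) (by fun_prop) (by fun_prop)
        (by fun_prop)
    refine rePred_and ?_ ?_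
    · exact rePred_gen_eq_comap_scaleHom (fun y => hk₀ y.1) (by fun_prop) (by fun_prop)
        (by fun_prop)
    · exact rePred_isRootTransversal (fun y => hk₀ y.1) (by fun_prop) (by fun_prop) (by fun_prop)
  refine hre.of_eq fun a => ⟨?_, fun h => ?_⟩
  · rintro ⟨hpow, hgen, Q, hQ, htrans⟩
    exact ⟨hpow, hgen, gen_map_fst_eq_rootBase hQ ▸ htrans⟩
  · obtain ⟨Q, hQ⟩ := exists_gen_eq (fg_comap_scaleHom (L a) (hk₀ a))
    exact ⟨h.pow_mem, h.gen_eq, Q, hQ, (gen_map_fst_eq_rootBase hQ).symm ▸ h.isRootTransversal⟩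

end RootSystemComputable

section Order

variable {G : Type*} [Group G] {H : Subgroup G} {g h : G} {k : ℕ}

theorem mem_ofOrder_iff (hk : 0 < k) :
    g ∈ ofOrder k (H : Set G) ↔ g ^ k ∈ H ∧ ∀ j < k, j = 0 ∨ g ^ j ∉ H := by
  change sInf {j : ℕ | 1 ≤ j ∧ g ^ j ∈ H} = k ↔ _
  constructor
  · rintro rfl
    refine ⟨(Nat.sInf_mem (Nat.nonempty_of_pos_sInf hk)).2, fun j hj => ?_⟩
    have hmin := Nat.notMem_of_lt_sInf hj
    exact (Nat.eq_zero_or_pos j).imp_right fun hj₀ hgj => hmin ⟨hj₀, hgj⟩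
  · rintro ⟨hgk, hmin⟩
    refine IsLeast.csInf_eq ⟨⟨hk, hgk⟩, fun j ⟨hj₀, hgj⟩ => ?_⟩
    by_contra! hjk
    exact (hmin j hjk).elim (Nat.one_le_iff_ne_zero.1 hj₀) fun h => h hgj

theorem ofOrder_subset_kRoots (hk : 0 < k) : ofOrder k (H : Set G) ⊆ kRoots k H := fun _ hg =>
  ((mem_ofOrder_iff hk).1 hg).1

theorem conj_mem_ofOrder_iff (hk : 0 < k) (hh : h ∈ H) :
    h⁻¹ * g * h ∈ ofOrder k (H : Set G) ↔ g ∈ ofOrder k (H : Set G) := by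
  simp only [mem_ofOrder_iff hk, conj_pow_mem_iff hh]

end Order

section OrderGroup

variable {G A : Type*} [Group G] [CommGroup A] {H K : Subgroup (G × A)}
  {g t w x : G × A} {j k : ℕ}

theorem mul_pow_mem_iff_of_mem_powGroup (hw : w ∈ powGroup H g j)
    (ht : t ∈ rootStab (saturation H) g j) : (w * t * g) ^ j ∈ H ↔ (t * g) ^ j ∈ H := by
  obtain ⟨B, _, q, hq⟩ := exists_monoidHom_saturation_ker_eq H
  obtain ⟨δ, hδ⟩ := exists_monoidHom_mul_pow q g j
  have hδw : δ ⟨w, hw.1⟩ = 1 := by rw [hδ, hq]; exact hw.2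
  have heq : δ (⟨w, hw.1⟩ * ⟨t, ht⟩) = δ ⟨t, ht⟩ := by rw [map_mul, hδw, one_mul]
  rw [hδ, hδ, ← mul_inv_eq_one, ← map_inv, ← map_mul, hq] at heq
  have hdiv : (w * t * g) ^ j * ((t * g) ^ j)⁻¹ ∈ H := by simpa [mul_assoc] using heq
  exact ⟨fun h => by simpa using mul_mem (inv_mem hdiv) h,
    fun h => by simpa using mul_mem hdiv h⟩

/- If `q` is the quotient map `H A → H A / H`, then `x ↦ q ((x * g) ^ j * (g ^ j)⁻¹)` is a
homomorphism from `K` whose values have exponent `k`. -/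
theorem relIndex_powGroup_ne_zero (hK : K ≤ powGroup H g k) (hfg : K.FG) (hk : 0 < k)
    (hg : g ^ k ∈ H) (hjk : j ≤ k) (hgj : g ^ j ∈ saturation H) :
    (powGroup H g j).relIndex K ≠ 0 := by
  obtain ⟨B, _, q, hq⟩ := exists_monoidHom_saturation_ker_eq H
  obtain ⟨δ, hδ⟩ := exists_monoidHom_mul_pow q g j
  have hle : K ≤ rootStab (saturation H) g j := fun x hx => rootStab_anti hjk (hK hx).1
  let η : K →* B := δ.comp (Subgroup.inclusion hle)
  have hq_pow : ∀ y, y ^ k ∈ H → ∀ hy : y ^ j ∈ saturation H, q ⟨y ^ j, hy⟩ ^ k = 1 := by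
    intro y hyk hy
    rw [← map_pow, hq]
    change (y ^ j) ^ k ∈ H
    rw [pow_right_comm]
    exact pow_mem hyk j
  have hη_pow : ∀ x, η x ^ k = 1 := fun x => by
    have hxk : (x * g) ^ k ∈ H := (H.mul_mem_cancel_right (inv_mem hg)).1 (hK x.2).2
    have hxj : (x * g) ^ j ∈ saturation H :=
      ((saturation H).mul_mem_cancel_right (inv_mem hgj)).1 (mul_pow_mul_inv_mem (hle x.2) le_rfl)
    have hη : η x = q ⟨_, hxj⟩ * (q ⟨_, hgj⟩)⁻¹ := by
      rw [MonoidHom.comp_apply, hδ, ← map_inv, ← map_mul]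
      rfl
    rw [hη, mul_pow, inv_pow, hq_pow _ hxk, hq_pow _ hg, inv_one, mul_one]
  have : Group.FG K := (Group.fg_iff_subgroup_fg K).2 hfg
  have : Finite η.range := CommGroup.finite_of_fg_isMulTorsion _ <| by
    rintro ⟨_, x, rfl⟩
    exact isOfFinOrder_iff_pow_eq_one.2 ⟨k, hk, Subtype.ext (hη_pow x)⟩
  have hker : (powGroup H g j).subgroupOf K = η.ker := by
    ext x
    rw [Subgroup.mem_subgroupOf, mem_powGroup, MonoidHom.mem_ker, MonoidHom.comp_apply, hδ, hq]
    exact and_iff_right (hle x.2)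
  rw [Subgroup.relIndex, hker]
  exact (Subgroup.finiteIndex_ker η).index_ne_zero

/-- A subgroup of finite index of `rootGroup H g k` such that left multiplication by its elements
preserves the order in `H` of the elements of the coset `rootGroup H g k * g`. The powers `g ^ j`
outside `saturation H` are left out: no power `(t * g) ^ j` with `t ∈ rootGroup H g k` is then an
element of `H`. -/
def orderGroup (H : Subgroup (G × A)) (g : G × A) (k : ℕ) : Subgroup (G × A) :=
  rootGroup H g k ⊓ ⨅ j : {j : Fin k // g ^ (j : ℕ) ∈ saturation H}, powGroup H g j

theorem mem_orderGroup : x ∈ orderGroup H g k ↔ x ∈ rootGroup H g k ∧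
    ∀ j < k, g ^ j ∉ saturation H ∨ (x * g) ^ j * (g ^ j)⁻¹ ∈ H := by
  rw [orderGroup, Subgroup.mem_inf, Subgroup.mem_iInf]
  refine and_congr_right fun hx => ?_
  have hstab : ∀ j < k, x ∈ rootStab (saturation H) g j := fun j hj => rootStab_anti hj.le hx.2.1
  constructor
  · exact fun h j hj => or_iff_not_imp_left.2 fun hgj => (h ⟨⟨j, hj⟩, not_not.1 hgj⟩).2
  · rintro h ⟨⟨j, hj⟩, hgj⟩
    exact ⟨hstab j hj, (h j hj).resolve_left (not_not.2 hgj)⟩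

theorem isFiniteRelIndex_orderGroup (hfg : (rootGroup H g k).FG) (hk : 0 < k) (hg : g ^ k ∈ H) :
    (orderGroup H g k).IsFiniteRelIndex (rootGroup H g k) := by
  refine ⟨?_⟩
  rw [orderGroup, Subgroup.inf_relIndex_left]
  exact Subgroup.relIndex_iInf_ne_zero fun j =>
    relIndex_powGroup_ne_zero inf_le_right hfg hk hg j.1.2.le j.2

theorem mul_mem_ofOrder_iff_of_mem_orderGroup (hk : 0 < k)
    (hw : w ∈ orderGroup H g k) (ht : t ∈ rootGroup H g k) :
    w * t * g ∈ ofOrder k (H : Set (G × A)) ↔ t * g ∈ ofOrder k (H : Set (G × A)) := by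
  rw [mem_ofOrder_iff hk, mem_ofOrder_iff hk, mul_pow_mem_iff_of_mem_powGroup hw.1.2 ht.2.1]
  refine and_congr_right fun _ => forall₂_congr fun j hj => or_congr_right (not_congr ?_)
  have hstab := rootStab_anti hj.le ht.2.1
  by_cases hgj : g ^ j ∈ saturation H
  · exact mul_pow_mem_iff_of_mem_powGroup (Subgroup.mem_iInf.1 hw.2 ⟨⟨j, hj⟩, hgj⟩) hstab
  · have hnot : ∀ x ∈ rootGroup H g k, (x * g) ^ j ∉ H := fun x hx hxH => hgj <| by
      have hpow := mul_pow_mul_inv_mem hx.2.1 hj.le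
      simpa using mul_mem (inv_mem hpow) (le_saturation hxH)
    exact iff_of_false (hnot _ (mul_mem hw.1 ht)) (hnot _ ht)

end OrderGroup

section Refinement

variable {G : Type*} [Group G] {H : Subgroup G} {X Y : Set G}

/-- The set `X` is the disjoint union of the cosets listed in `F`, whose representatives lie in
`X`. In contrast to `IsDecomposition`, no conjugates are added. -/
structure IsCosetPartition (X : Set G) (F : List (List G × G)) : Prop where
  rep_mem : ∀ c ∈ F, c.2 ∈ X
  disjoint : F.Pairwise fun c c' =>
    Disjoint (rightCoset (gen c.1) c.2) (rightCoset (gen c'.1) c'.2)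
  eq : X = {g | ∃ c ∈ F, g ∈ rightCoset (gen c.1) c.2}

theorem IsCosetPartition.rightCoset_subset {F : List (List G × G)} (hF : IsCosetPartition X F)
    {c : List G × G} (hc : c ∈ F) : rightCoset (gen c.1) c.2 ⊆ X := fun x hx => by
  rw [hF.eq]
  exact ⟨c, hc, hx⟩

theorem IsDecomposition.flatMap {ι : Type*} {E : List ι} {c : ι → List G × G}
    {F : ι → List (List G × G)} (hE : IsDecomposition H X (E.map c)) (hYX : Y ⊆ X)
    (hconj : ∀ h ∈ H, ∀ y ∈ Y, h⁻¹ * y * h ∈ Y)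
    (hF : ∀ e ∈ E, IsCosetPartition (rightCoset (gen (c e).1) (c e).2 ∩ Y) (F e)) :
    IsDecomposition H Y (E.flatMap F) where
  rep_mem d hd := by
    obtain ⟨e, he, hde⟩ := List.mem_flatMap.1 hd
    exact ((hF e he).rep_mem d hde).2
  disjoint := by
    refine List.pairwise_flatMap.2 ⟨fun e he => (hF e he).disjoint, ?_⟩
    refine (List.pairwise_map.1 hE.disjoint).imp_of_mem fun {e e'} he he' hee' d hd d' hd' => ?_
    exact hee'.mono (fun x hx => ((hF e he).rightCoset_subset hd hx).1)
      (fun x hx => ((hF e' he').rightCoset_subset hd' hx).1)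
  eq := by
    ext y
    constructor
    · intro hy
      have hyX := hYX hy
      rw [hE.eq] at hyX
      obtain ⟨h, hh, x, ⟨_, hc, hx⟩, rfl⟩ := hyX
      obtain ⟨e, he, rfl⟩ := List.mem_map.1 hc
      have hxY : x ∈ Y := by simpa [mul_assoc] using hconj h⁻¹ (inv_mem hh) _ hy
      have hmem : x ∈ rightCoset (gen (c e).1) (c e).2 ∩ Y := ⟨hx, hxY⟩
      rw [(hF e he).eq] at hmem
      obtain ⟨d, hd, hxd⟩ := hmem
      exact ⟨h, hh, x, ⟨d, List.mem_flatMap.2 ⟨e, he, hd⟩, hxd⟩, rfl⟩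
    · rintro ⟨h, hh, x, ⟨d, hd, hx⟩, rfl⟩
      obtain ⟨e, he, hde⟩ := List.mem_flatMap.1 hd
      exact hconj h hh x ((hF e he).rightCoset_subset hde hx).2

end Refinement

section OrderSystem

variable {G A : Type*} [Group G] [CommGroup A] {H : Subgroup (G × A)} {k : ℕ}
  {c : List (G × A) × (G × A)} {W T R : List (G × A)}

/-- Data describing the elements of order `k` in the coset `K * g`, where `K` is generated by `c.1`
and `g = c.2`: the lists `T` and `R` together meet all cosets in `K` of a subgroup, generated by
`W`, of `orderGroup H g k`, and `T` consists of the `t` for which `t * g` has order `k`. -/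
structure IsOrderRefinement (H : Subgroup (G × A)) (k : ℕ) (c : List (G × A) × (G × A))
    (W T R : List (G × A)) : Prop where
  mem_orderGroup : ∀ w ∈ W, w ∈ orderGroup H c.2 k
  isCosetCover : IsCosetCover (gen c.1) (gen W) (T ++ R)
  separated : T.Pairwise fun t t' => t * t'⁻¹ ∉ gen W
  mem_ofOrder : ∀ t ∈ T, t * c.2 ∈ ofOrder k (H : Set (G × A))
  notMem_ofOrder : ∀ t ∈ R, t * c.2 ∉ ofOrder k (H : Set (G × A))

theorem IsOrderRefinement.isCosetPartition (h : IsOrderRefinement H k c W T R) (hk : 0 < k)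
    (hc : gen c.1 = rootGroup H c.2 k) :
    IsCosetPartition (rightCoset (gen c.1) c.2 ∩ ofOrder k (H : Set (G × A)))
      (T.map fun t => (W, t * c.2)) where
  rep_mem := by
    refine List.forall_mem_map.2 fun t ht => ⟨?_, h.mem_ofOrder t ht⟩
    exact ⟨t, h.isCosetCover.1 t (List.mem_append_left R ht), rfl⟩
  disjoint := by
    refine List.pairwise_map.2 (h.separated.imp fun {t t'} htt' => Set.disjoint_left.2 ?_)
    intro y hy hy'
    rw [mem_rightCoset_iff] at hy hy'
    refine htt' ?_
    simpa [mul_assoc] using mul_mem (inv_mem hy) hy'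
  eq := by
    have horder : ∀ w ∈ gen W, ∀ t ∈ T ++ R, w * t * c.2 ∈ ofOrder k (H : Set (G × A)) ↔
        t * c.2 ∈ ofOrder k (H : Set (G × A)) := fun w hw t ht =>
      mul_mem_ofOrder_iff_of_mem_orderGroup hk (gen_le_iff.2 h.mem_orderGroup hw)
        (hc ▸ h.isCosetCover.1 t ht)
    have hle : gen W ≤ gen c.1 := hc ▸ (gen_le_iff.2 h.mem_orderGroup).trans inf_le_left
    ext y
    constructor
    · rintro ⟨⟨x, hx, rfl⟩, hy⟩
      obtain ⟨t, ht, hxt⟩ := h.isCosetCover.2 x hx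
      have htk := (horder _ hxt t ht).1 (by simpa using hy)
      have htT := (List.mem_append.1 ht).resolve_right fun htR => h.notMem_ofOrder t htR htk
      exact ⟨_, List.mem_map_of_mem htT, x * t⁻¹, hxt, by simp⟩
    · rintro ⟨_, hd, w, hw, rfl⟩
      obtain ⟨t, ht, rfl⟩ := List.mem_map.1 hd
      have htTR := List.mem_append_left R ht
      rw [← mul_assoc]
      exact ⟨⟨_, mul_mem (hle hw) (h.isCosetCover.1 t htTR), rfl⟩,
        (horder w hw t htTR).2 (h.mem_ofOrder t ht)⟩

theorem exists_isOrderRefinement (hk : 0 < k) (hc : gen c.1 = rootGroup H c.2 k)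
    (hck : c.2 ^ k ∈ H) : ∃ W T R, IsOrderRefinement H k c W T R := by
  classical
  have hfg : (rootGroup H c.2 k).FG := hc ▸ fg_gen c.1
  have := isFiniteRelIndex_orderGroup hfg hk hck
  have hle : orderGroup H c.2 k ≤ rootGroup H c.2 k := inf_le_left
  obtain ⟨W, hW⟩ := exists_gen_eq (fg_of_isFiniteRelIndex hfg hle)
  obtain ⟨T, hcover, hsep⟩ := exists_isCosetCover (P := rootGroup H c.2 k)
    (Q := orderGroup H c.2 k)
  let hasOrder : G × A → Prop := fun t => t * c.2 ∈ ofOrder k (H : Set (G × A))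
  have hmem : ∀ t, t ∈ T.filter hasOrder ++ T.filter (¬ hasOrder ·) ↔ t ∈ T := fun t => by
    simp [← and_or_left, em]
  refine ⟨W, T.filter hasOrder, T.filter (¬ hasOrder ·), fun w hw => hW ▸ mem_gen_of_mem hw, ?_,
    hW ▸ hsep.filter _, fun t ht => ?_, fun t ht => ?_⟩
  · simpa only [IsCosetCover, hmem, hW, hc] using hcover
  · simpa using (List.mem_filter.1 ht).2
  · simpa using (List.mem_filter.1 ht).2

/-- A root system for `H` and `k` together with data describing the elements of order `k` in each
of its cosets. -/
structure IsOrderSystem (H : Subgroup (G × A)) (k : ℕ)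
    (E : List ((List (G × A) × (G × A)) × List (G × A) × List (G × A) × List (G × A))) :
    Prop where
  isRootSystem : IsRootSystem H k (E.map Prod.fst)
  isOrderRefinement : ∀ e ∈ E, IsOrderRefinement H k e.1 e.2.1 e.2.2.1 e.2.2.2

/-- The cosets of elements of order `k` listed by an order system. -/
def orderCosets
    (E : List ((List (G × A) × (G × A)) × List (G × A) × List (G × A) × List (G × A))) :
    List (List (G × A) × (G × A)) :=
  E.flatMap fun e => e.2.2.1.map fun t => (e.2.1, t * e.1.2)

theorem IsOrderSystem.isDecomposition
    {E : List ((List (G × A) × (G × A)) × List (G × A) × List (G × A) × List (G × A))}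
    (hE : IsOrderSystem H k E) (hk : 0 < k) :
    IsDecomposition H (ofOrder k (H : Set (G × A))) (orderCosets E) :=
  hE.isRootSystem.isDecomposition.flatMap (ofOrder_subset_kRoots hk)
    (fun _ hh _ hy => (conj_mem_ofOrder_iff hk hh).2 hy)
    fun e he => (hE.isOrderRefinement e he).isCosetPartition hk
      (hE.isRootSystem.gen_eq e.1 (List.mem_map_of_mem he))

theorem exists_isOrderSystem {D : List (List (G × A) × (G × A))} (hD : IsRootSystem H k D)
    (hk : 0 < k) : ∃ E, IsOrderSystem H k E := by
  choose! W T R h using fun c (hc : c ∈ D) =>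
    exists_isOrderRefinement hk (hD.gen_eq c hc) (hD.pow_mem c hc)
  refine ⟨D.map fun c => (c, W c, T c, R c), ?_, List.forall_mem_map.2 h⟩
  simpa [Function.comp_def] using hD

end OrderSystem

section OrderSystemComputable

variable {α : Type*} [Primcodable α] {n m : ℕ}

section Order

variable {G : Type*} [Group G] [Primcodable G] [PrimrecGroup G] [SolvableMembership G]
  {L : α → List G} {k : α → ℕ} {g : α → G}

@[fun_prop]
theorem rePred_mem_ofOrder (hk₀ : ∀ a, 0 < k a) (hL : Primrec L) (hk : Primrec k)
    (hg : Primrec g) : REPred fun a => g a ∈ ofOrder (k a) (gen (L a) : Set G) := by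
  simp only [mem_ofOrder_iff (hk₀ _)]
  refine rePred_and (rePred_mem_gen (by fun_prop) hL) (rePred_forall_lt ?_ hk)
  exact rePred_or (by fun_prop) (rePred_notMem_gen (by fun_prop) (by fun_prop))

@[fun_prop]
theorem rePred_notMem_ofOrder (hk₀ : ∀ a, 0 < k a) (hL : Primrec L) (hk : Primrec k)
    (hg : Primrec g) : REPred fun a => g a ∉ ofOrder (k a) (gen (L a) : Set G) := by
  have hre : REPred fun a => g a ^ k a ∉ gen (L a) ∨
      ∃ j < k a, j ≠ 0 ∧ g a ^ j ∈ gen (L a) := by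
    refine rePred_or (rePred_notMem_gen (by fun_prop) hL) (rePred_exists_lt ?_ hk)
    exact rePred_and (by fun_prop) (rePred_mem_gen (by fun_prop) (by fun_prop))
  refine hre.of_eq fun a => ?_
  rw [mem_ofOrder_iff (hk₀ a), not_and_or]
  push Not
  rfl

end Order

variable {L : α → List (FTA n m)} {k : α → ℕ}

@[fun_prop]
theorem rePred_mem_orderGroup {x g : α → FTA n m} (hk₀ : ∀ a, 0 < k a) (hL : Primrec L)
    (hk : Primrec k) (hg : Primrec g) (hx : Primrec x) :
    REPred fun a => x a ∈ orderGroup (gen (L a)) (g a) (k a) := by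
  have hre : REPred fun a =>
      (∃ W : List (FTA n m), gen W = rootGroup (gen (L a)) (g a) (k a) ∧ x a ∈ gen W) ∧
      ∀ j < k a, (g a ^ j).1 ∉ gen ((L a).map Prod.fst) ∨
        (x a * g a) ^ j * (g a ^ j)⁻¹ ∈ gen (L a) := by
    refine rePred_and (rePred_exists ?_) (rePred_forall_lt ?_ hk)
    · exact rePred_and (rePred_gen_eq_rootGroup (fun y => hk₀ y.1) (by fun_prop) (by fun_prop)
        (by fun_prop) (by fun_prop)) (rePred_mem_gen (by fun_prop) (by fun_prop))
    · exact rePred_or (rePred_notMem_gen (by fun_prop) (by fun_prop))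
        (rePred_mem_gen (by fun_prop) (by fun_prop))
  refine hre.of_eq fun a => ?_
  rw [mem_orderGroup, saturation, gen_map_fst]
  refine and_congr_left fun _ => ⟨fun ⟨_, hW, hx⟩ => hW ▸ hx, fun hx => ?_⟩
  obtain ⟨W, hW⟩ := exists_gen_eq (fg_rootGroup_gen (L a) (g a) (hk₀ a))
  exact ⟨W, hW, hW ▸ hx⟩

@[fun_prop]
theorem rePred_isOrderRefinement {c : α → List (FTA n m) × FTA n m}
    {W T R : α → List (FTA n m)} (hk₀ : ∀ a, 0 < k a) (hL : Primrec L) (hk : Primrec k)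
    (hc : Primrec c) (hW : Primrec W) (hT : Primrec T) (hR : Primrec R) :
    REPred fun a => IsOrderRefinement (gen (L a)) (k a) (c a) (W a) (T a) (R a) := by
  have hre : REPred fun a => (∀ w ∈ W a, w ∈ orderGroup (gen (L a)) (c a).2 (k a)) ∧
      IsCosetCover (gen (c a).1) (gen (W a)) (T a ++ R a) ∧
      (T a).Pairwise (fun t t' => t * t'⁻¹ ∉ gen (W a)) ∧
      (∀ t ∈ T a, t * (c a).2 ∈ ofOrder (k a) (gen (L a) : Set (FTA n m))) ∧
      ∀ t ∈ R a, t * (c a).2 ∉ ofOrder (k a) (gen (L a) : Set (FTA n m)) := by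
    refine rePred_and (rePred_ball ?_ hW) (rePred_and (by fun_prop)
      (rePred_and (rePred_pairwise ?_ hT) (rePred_and (rePred_ball ?_ hT) (rePred_ball ?_ hR))))
    · exact rePred_mem_orderGroup (fun y => hk₀ y.1) (by fun_prop) (by fun_prop) (by fun_prop)
        (by fun_prop)
    · exact rePred_notMem_gen (by fun_prop) (by fun_prop)
    · exact rePred_mem_ofOrder (fun y => hk₀ y.1) (by fun_prop) (by fun_prop) (by fun_prop)
    · exact rePred_notMem_ofOrder (fun y => hk₀ y.1) (by fun_prop) (by fun_prop) (by fun_prop)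
  exact hre.of_eq fun a => ⟨fun ⟨h₁, h₂, h₃, h₄, h₅⟩ => ⟨h₁, h₂, h₃, h₄, h₅⟩,
    fun ⟨h₁, h₂, h₃, h₄, h₅⟩ => ⟨h₁, h₂, h₃, h₄, h₅⟩⟩

theorem rePred_isOrderSystem
    {E : α → List ((List (FTA n m) × FTA n m) × List (FTA n m) × List (FTA n m) × List (FTA n m))}
    (hk₀ : ∀ a, 0 < k a) (hL : Primrec L) (hk : Primrec k) (hE : Primrec E) :
    REPred fun a => IsOrderSystem (gen (L a)) (k a) (E a) := by
  have hre : REPred fun a => IsRootSystem (gen (L a)) (k a) ((E a).map Prod.fst) ∧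
      ∀ e ∈ E a, IsOrderRefinement (gen (L a)) (k a) e.1 e.2.1 e.2.2.1 e.2.2.2 := by
    refine rePred_and (rePred_isRootSystem hk₀ hL hk (by fun_prop)) (rePred_ball ?_ hE)
    exact rePred_isOrderRefinement (fun y => hk₀ y.1) (by fun_prop) (by fun_prop) (by fun_prop)
      (by fun_prop) (by fun_prop) (by fun_prop)
  exact hre.of_eq fun a => ⟨fun ⟨h₁, h₂⟩ => ⟨h₁, h₂⟩, fun ⟨h₁, h₂⟩ => ⟨h₁, h₂⟩⟩

theorem primrec_orderCosets : Primrec (orderCosets (G := FreeGroup (Fin n))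
    (A := Multiplicative (Fin m → ℤ))) := by
  unfold orderCosets
  fun_prop

end OrderSystemComputable

section Codes

variable {n m : ℕ}

theorem subgroupOf_eq_gen (L : List (Code n m)) : subgroupOf L = gen (L.map Code.elt) := by
  rw [subgroupOf, gen]
  congr 1
  ext
  simp

/-- The code of an element, with a reduced word. -/
def code (g : FTA n m) : Code n m := (g.1.toWord, g.2.toAdd)

theorem elt_code (g : FTA n m) : Code.elt (code g) = g := Prod.ext FreeGroup.mk_toWord rfl

/-- The code of the coset given by generators of a subgroup and a representative. -/
def cosetCode (c : List (FTA n m) × FTA n m) : CosetCode n m := (c.1.map code, code c.2)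

theorem rep_cosetCode (c : List (FTA n m) × FTA n m) : CosetCode.rep (cosetCode c) = c.2 :=
  elt_code c.2

theorem coset_cosetCode (c : List (FTA n m) × FTA n m) :
    CosetCode.coset (cosetCode c) = rightCoset (gen c.1) c.2 := by
  rw [CosetCode.coset, rep_cosetCode, subgroupOf_eq_gen, cosetCode, List.map_map]
  simp [Function.comp_def, elt_code]

theorem IsDecomposition.isCosetDecomposition {H : Subgroup (FTA n m)} {X : Set (FTA n m)}
    {D : List (List (FTA n m) × FTA n m)} (hD : IsDecomposition H X D) :
    IsCosetDecomposition H X (D.map cosetCode) where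
  rep_mem := List.forall_mem_map.2 fun c hc => (rep_cosetCode c).symm ▸ hD.rep_mem c hc
  disjoint := List.pairwise_map.2 (by simpa only [coset_cosetCode] using hD.disjoint)
  eq := by simpa only [List.mem_map, exists_exists_and_eq_and, coset_cosetCode] using hD.eq

theorem IsCosetDecomposition.ne_nil_iff {H : Subgroup (FTA n m)} {X : Set (FTA n m)}
    {D : List (CosetCode n m)} (hD : IsCosetDecomposition H X D) : D ≠ [] ↔ X.Nonempty := by
  constructor
  · intro hne
    obtain ⟨c, hc⟩ := List.exists_mem_of_ne_nil D hne
    exact ⟨_, hD.rep_mem c hc⟩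
  · rintro ⟨x, hx⟩ rfl
    rw [hD.eq] at hx
    obtain ⟨_, _, _, ⟨c, hc, _⟩, _⟩ := hx
    exact List.not_mem_nil hc

variable {α : Type*} [Primcodable α]

@[fun_prop]
theorem primrec_elt {f : α → Code n m} (hf : Primrec f) : Primrec fun a => Code.elt (f a) := by
  unfold Code.elt
  fun_prop

@[fun_prop]
theorem primrec_cosetCode {f : α → List (FTA n m) × FTA n m} (hf : Primrec f) :
    Primrec fun a => cosetCode (f a) := by
  unfold cosetCode code
  fun_prop

end Codes

section Algorithms

variable (n m : ℕ)

/- The exponent `k` is read as `k - 1 + 1`, so that the searches terminate on all inputs. -/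
theorem exists_computable_isRootSystem :
    ∃ f : List (Code n m) × ℕ → List (List (FTA n m) × FTA n m), Computable f ∧
      ∀ L k, 1 ≤ k → IsRootSystem (subgroupOf L) k (f (L, k)) := by
  obtain ⟨f, hf, h⟩ := exists_computable_of_rePred
    (p := fun (x : List (Code n m) × ℕ) D =>
      IsRootSystem (gen (x.1.map Code.elt)) (x.2 - 1 + 1) D)
    (rePred_isRootSystem (fun _ => Nat.succ_pos _) (by fun_prop) (by fun_prop) (by fun_prop))
    fun _ => exists_isRootSystem _ (Nat.succ_pos _)
  refine ⟨f, hf, fun L k hk => ?_⟩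
  simpa only [subgroupOf_eq_gen, Nat.sub_add_cancel hk] using h (L, k)

theorem exists_computable_isOrderSystem :
    ∃ f : List (Code n m) × ℕ →
        List ((List (FTA n m) × FTA n m) × List (FTA n m) × List (FTA n m) × List (FTA n m)),
      Computable f ∧ ∀ L k, 1 ≤ k → IsOrderSystem (subgroupOf L) k (f (L, k)) := by
  obtain ⟨f, hf, h⟩ := exists_computable_of_rePred
    (p := fun (x : List (Code n m) × ℕ) E =>
      IsOrderSystem (gen (x.1.map Code.elt)) (x.2 - 1 + 1) E)
    (rePred_isOrderSystem (fun _ => Nat.succ_pos _) (by fun_prop) (by fun_prop) (by fun_prop))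
    fun _ =>
      have ⟨_, hD⟩ := exists_isRootSystem _ (Nat.succ_pos _)
      exists_isOrderSystem hD (Nat.succ_pos _)
  refine ⟨f, hf, fun L k hk => ?_⟩
  simpa only [subgroupOf_eq_gen, Nat.sub_add_cancel hk] using h (L, k)

theorem exists_computable_rootCosets :
    ∃ f : List (Code n m) × ℕ → List (CosetCode n m), Computable f ∧ ∀ L k, 1 ≤ k →
      IsCosetDecomposition (subgroupOf L) (kRoots k (subgroupOf L : Set (FTA n m))) (f (L, k)) ∧
      (f (L, k)).Pairwise fun c c' => (CosetCode.rep c).1 ≠ (CosetCode.rep c').1 := by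
  obtain ⟨f, hf, h⟩ := exists_computable_isRootSystem n m
  have hcode : Primrec fun D : List (List (FTA n m) × FTA n m) => D.map cosetCode := by fun_prop
  refine ⟨_, hcode.to_comp.comp hf, fun L k hk =>
    ⟨(h L k hk).isDecomposition.isCosetDecomposition, List.pairwise_map.2 ?_⟩⟩
  simpa only [rep_cosetCode] using (h L k hk).pairwise_fst_ne

theorem exists_computable_decide_mem_ofOrder :
    ∃ f : List (Code n m) × ℕ × Code n m → Bool, Computable f ∧ ∀ L k x, 1 ≤ k →
      (f (L, k, x) = true ↔ Code.elt x ∈ ofOrder k (subgroupOf L : Set (FTA n m))) := by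
  obtain ⟨f, hf, h⟩ := exists_computable_decide
    (p := fun x : List (Code n m) × ℕ × Code n m =>
      Code.elt x.2.2 ∈ ofOrder (x.2.1 - 1 + 1) (gen (x.1.map Code.elt) : Set (FTA n m)))
    (rePred_mem_ofOrder (fun _ => Nat.succ_pos _) (by fun_prop) (by fun_prop) (by fun_prop))
    (rePred_notMem_ofOrder (fun _ => Nat.succ_pos _) (by fun_prop) (by fun_prop) (by fun_prop))
  refine ⟨f, hf, fun L k x hk => ?_⟩
  simpa only [subgroupOf_eq_gen, Nat.sub_add_cancel hk] using h (L, k, x)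

theorem exists_computable_orderCosets :
    ∃ f : List (Code n m) × ℕ → List (CosetCode n m), Computable f ∧ ∀ L k, 1 ≤ k →
      IsCosetDecomposition (subgroupOf L) (ofOrder k (subgroupOf L : Set (FTA n m)))
        (f (L, k)) := by
  obtain ⟨f, hf, h⟩ := exists_computable_isOrderSystem n m
  have hcode : Primrec fun D : List (List (FTA n m) × FTA n m) => D.map cosetCode := by fun_prop
  exact ⟨_, (hcode.comp primrec_orderCosets).to_comp.comp hf, fun L k hk =>
    ((h L k hk).isDecomposition hk).isCosetDecomposition⟩

theorem exists_computable_decide_ne_nil (β : Type*) [Primcodable β] :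
    ∃ f : List β → Bool, Computable f ∧ ∀ l, f l = true ↔ l ≠ [] :=
  exists_computable_decide (by fun_prop) (by simpa only [ne_eq, not_not] using by fun_prop)

end Algorithms

end FreeTimesAbelian

theorem mainTheorem11 (n m : ℕ) :
    -- the set of `k`-roots
    (∃ roots : List (FreeTimesAbelian.Code n m) × ℕ → List (FreeTimesAbelian.CosetCode n m),
      Computable roots ∧
      ∀ (L : List (FreeTimesAbelian.Code n m)) (k : ℕ), 1 ≤ k →
        FreeTimesAbelian.IsCosetDecomposition (FreeTimesAbelian.subgroupOf L)
          (FreeTimesAbelian.kRoots k (FreeTimesAbelian.subgroupOf L : Set (FreeTimesAbelian.FTA n m))) (roots (L, k)) ∧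
        -- the free parts of the representatives are distinct
        (roots (L, k)).Pairwise fun c c' =>
          (FreeTimesAbelian.CosetCode.rep c).1 ≠ (FreeTimesAbelian.CosetCode.rep c').1) ∧
    -- membership in the set of elements of order `k` is decidable
    (∃ mem : List (FreeTimesAbelian.Code n m) × ℕ × FreeTimesAbelian.Code n m → Bool,
      Computable mem ∧
      ∀ (L : List (FreeTimesAbelian.Code n m)) (k : ℕ) (x : FreeTimesAbelian.Code n m), 1 ≤ k →
        (mem (L, k, x) = true ↔ FreeTimesAbelian.Code.elt x ∈
          FreeTimesAbelian.ofOrder k (FreeTimesAbelian.subgroupOf L : Set (FreeTimesAbelian.FTA n m)))) ∧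
    -- non-emptiness of the set of elements of order `k` is decidable
    (∃ dec : List (FreeTimesAbelian.Code n m) × ℕ → Bool,
      Computable dec ∧
      ∀ (L : List (FreeTimesAbelian.Code n m)) (k : ℕ), 1 ≤ k →
        (dec (L, k) = true ↔
          (FreeTimesAbelian.ofOrder k (FreeTimesAbelian.subgroupOf L : Set (FreeTimesAbelian.FTA n m))).Nonempty)) ∧
    -- the set of elements of order `k`
    (∃ elts : List (FreeTimesAbelian.Code n m) × ℕ → List (FreeTimesAbelian.CosetCode n m),
      Computable elts ∧
      ∀ (L : List (FreeTimesAbelian.Code n m)) (k : ℕ), 1 ≤ k →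
        FreeTimesAbelian.IsCosetDecomposition (FreeTimesAbelian.subgroupOf L)
          (FreeTimesAbelian.ofOrder k (FreeTimesAbelian.subgroupOf L : Set (FreeTimesAbelian.FTA n m)))
          (elts (L, k))) := by
  obtain ⟨roots, hroots, hroots_spec⟩ := FreeTimesAbelian.exists_computable_rootCosets n m
  obtain ⟨elts, helts, helts_spec⟩ := FreeTimesAbelian.exists_computable_orderCosets n m
  obtain ⟨neNil, hneNil, hneNil_spec⟩ :=
    FreeTimesAbelian.exists_computable_decide_ne_nil (FreeTimesAbelian.CosetCode n m)
  refine ⟨⟨roots, hroots, hroots_spec⟩,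
    FreeTimesAbelian.exists_computable_decide_mem_ofOrder n m,
    ⟨fun x => neNil (elts x), hneNil.comp helts, fun L k hk => ?_⟩, elts, helts, helts_spec⟩
  exact (hneNil_spec _).trans (helts_spec L k hk).ne_nil_iff
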